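/- An alternating quantum-classical circuit on a grid of qubits consists of $d$ rounds. In each round, (i) a classical Boolean circuit computes control bits from the outcomes of the earlier measurements; (ii) a quantum circuit is applied that consists of arbitrary single-qubit unitaries and of CNOT gates between directly neighbouring qubits of the grid, where each gate may be applied conditionally on one of the control bits; (iii) a subset of the qubits is measured in the computational basis. A family $(A_n)$ of such circuits is an $\mathsf{LAQCC}=\mathsf{LAQCC}(\mathsf{QNC}^0,\mathsf{NC}^1,O(1))$ family if the number of rounds and the depth of all quantum circuits are bounded by constants independent of $n$, and the classical circuits are $\mathsf{NC}^1$-circuits, that is, they use AND- and OR-gates of fan-in two and NOT-gates and have depth $O(\log n)$ and size polynomial in $n$. (No uniformity of the family is required.) The circuit $A_n$ prepares an $n$-qubit state $|\psi\rangle$ if, when it is started with all qubits in $|0\rangle$, for every sequence of measurement outcomes that occurs with nonzero probability the final state is, up to a global phase, $|\psi\rangle$ on $n$ fixed qubits of the grid and $|0\rangle$ on all other qubits. Theorem. There is an $\mathsf{LAQCC}$ family of circuits $(A_n)$ such that, for every $n\ge 1$, $A_n$ prepares the $n$-qubit $W$-state $$|W\rangle=\frac{1}{\sqrt n}\sum_{i=1}^{n}|e_i\rangle,$$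 where $|e_i\rangle$ is the computational basis state with a one at position $i$ and zeros elsewhere. The circuit $A_n$ uses $O(n\log n\log\log n)$ qubits, placed in a grid of size $n\times O(\log n\log\log n)$. -/

import Mathlib

open Filter Asymptotics

/-! ### Classical (conventional) circuits -/

/-- Boolean circuits with one output and gates AND, OR (fan-in two), NOT, in which every gate has
fan-out one. A fan-in-two circuit of logarithmic depth unfolds, output bit by output bit, into such
formulas of logarithmic depth and polynomial size, so these describe `NC¹`. -/
inductive BoolFormula (α : Type) : Type
  | var (a : α) : BoolFormula α
  | const (b : Bool) : BoolFormula α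
  | not (f : BoolFormula α) : BoolFormula α
  | and (f g : BoolFormula α) : BoolFormula α
  | or (f g : BoolFormula α) : BoolFormula α

namespace BoolFormula

/-- The value of the output bit on the input `v`. -/
def eval {α : Type} (v : α → Bool) : BoolFormula α → Bool
  | var a => v a
  | const b => b
  | not f => !(f.eval v)
  | and f g => f.eval v && g.eval v
  | or f g => f.eval v || g.eval v

/-- The largest number of gates on a path from an input to the output. -/
def depth {α : Type} : BoolFormula α → ℕ
  | var _ => 0
  | const _ => 0
  | not f => f.depth + 1
  | and f g => max f.depth g.depth + 1
  | or f g => max f.depth g.depth + 1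

/-- The number of gates and leaves. -/
def size {α : Type} : BoolFormula α → ℕ
  | var _ => 1
  | const _ => 1
  | not f => f.size + 1
  | and f g => f.size + g.size + 1
  | or f g => f.size + g.size + 1

end BoolFormula

/-! ### Quantum states and gates -/

/-- Vectors of the Hilbert space `(ℂ²)^{⊗ Q}` of a set `Q` of qubits, given by their amplitudes
in the computational basis. They need not be normalized. -/
abbrev QState (Q : Type) : Type := (Q → Bool) → ℂ

/-- The computational basis state `|y⟩`. -/
noncomputable def ket {Q : Type} (y : Q → Bool) : QState Q :=
  open Classical in fun x => if x = y then 1 else 0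

/-- Gates on the qubits `Q` with connectivity graph `G`: all single-qubit unitaries, and CNOT
gates between neighbouring qubits. -/
inductive QGate {Q : Type} (G : SimpleGraph Q) : Type
  | single (q : Q) (U : Matrix.unitaryGroup Bool ℂ) : QGate G
  | cnot (control target : Q) (h : G.Adj control target) : QGate G

namespace QGate

variable {Q : Type} [DecidableEq Q] {G : SimpleGraph Q}

/-- The qubits on which a gate acts. -/
def support : QGate G → Finset Q
  | single q _ => {q}
  | cnot a b _ => {a, b}

/-- The action of a gate on states. -/
noncomputable def apply : QGate G → QState Q → QState Q
  | single q U, ψ => fun x => ∑ b : Bool, U.1 (x q) b * ψ (Function.update x q b)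
  | cnot a b _, ψ => fun x => ψ (Function.update x b (xor (x b) (x a)))

end QGate

/-- A gate that is either applied unconditionally (`ctrl = none`), or applied if and only if one of
`k` classical control bits equals one. -/
structure ControlledQGate {Q : Type} (G : SimpleGraph Q) (k : ℕ) where
  gate : QGate G
  ctrl : Option (Fin k)

/-- The action of a classically controlled gate, given the control bits `y`. -/
noncomputable def ControlledQGate.apply {Q : Type} [DecidableEq Q] {G : SimpleGraph Q} {k : ℕ}
    (g : ControlledQGate G k) (y : Fin k → Bool) (ψ : QState Q) : QState Q :=
  match g.ctrl with
  | none => g.gate.apply ψ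
  | some j => if y j then g.gate.apply ψ else ψ

/-- A depth-one quantum circuit: gates that act on pairwise disjoint sets of qubits. -/
structure DepthOneLayer {Q : Type} [DecidableEq Q] (G : SimpleGraph Q) (k : ℕ) where
  gates : List (ControlledQGate G k)
  disjoint : gates.Pairwise fun g g' => Disjoint g.gate.support g'.gate.support

/-- The action of a depth-one circuit (the order of the gates does not matter, as they are
disjoint). -/
noncomputable def DepthOneLayer.apply {Q : Type} [DecidableEq Q] {G : SimpleGraph Q} {k : ℕ}
    (L : DepthOneLayer G k) (y : Fin k → Bool) (ψ : QState Q) : QState Q :=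
  L.gates.foldl (fun φ g => g.apply y φ) ψ

/-! ### Alternating quantum-classical circuits -/

/-- One round `M U C` of an alternating circuit. First a classical circuit `C` computes `bits`
control bits from the outcomes of the earlier measurements: its input variable `(j, q)` is the
outcome for the qubit `q` in the measurement made `j + 1` rounds ago. Then a quantum circuit `U`
is applied, given as a list of depth-one circuits whose gates may be controlled by these bits.
Finally the qubits in `measured` are measured in the computational basis. -/
structure HybridRound {Q : Type} [DecidableEq Q] (G : SimpleGraph Q) where
  bits : ℕ
  classical : Fin bits → BoolFormula (ℕ × Q)
  quantum : List (DepthOneLayer G bits)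
  measured : Finset Q

namespace HybridRound

variable {Q : Type} [DecidableEq Q] {G : SimpleGraph Q}

/-- The quantum circuit of the round, given the record `r` of the earlier outcomes. -/
noncomputable def applyQuantum (R : HybridRound G) (r : ℕ × Q → Bool) (ψ : QState Q) : QState Q :=
  R.quantum.foldl (fun φ L => L.apply (fun i => (R.classical i).eval r) φ) ψ

/-- The projection onto the outcome `o` of the measurement. The result is not normalized, so that
its squared norm is the probability of the outcome (times the squared norm of `ψ`). -/
noncomputable def project (R : HybridRound G) (o : R.measured → Bool) (ψ : QState Q) : QState Q :=
  fun x => if ∀ q : R.measured, x q = o q then ψ x else 0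

/-- The record after the round: the new outcomes are put in front of the old ones. Entries that do
not belong to a measurement read `false`. -/
def pushRecord (R : HybridRound G) (o : R.measured → Bool) (r : ℕ × Q → Bool) : ℕ × Q → Bool
  | (0, q) => if h : q ∈ R.measured then o ⟨q, h⟩ else false
  | (j + 1, q) => r (j, q)

end HybridRound

/-- An alternating circuit is a sequence of rounds. -/
abbrev HybridCircuit {Q : Type} [DecidableEq Q] (G : SimpleGraph Q) : Type :=
  List (HybridRound G)

namespace HybridCircuit

variable {Q : Type} [DecidableEq Q] {G : SimpleGraph Q}

/-- The unnormalized final states of all branches (one for each sequence of measurement outcomes),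
when the circuit is run from the state `ψ` and the record `r`. The squared norm of a final state is
the probability of its branch; the branches of probability zero contribute the zero vector. -/
def branches : HybridCircuit G → (ℕ × Q → Bool) → QState Q → Set (QState Q)
  | [], _, ψ => {ψ}
  | R :: A, r, ψ =>
      ⋃ o : R.measured → Bool, branches A (R.pushRecord o r) (R.project o (R.applyQuantum r ψ))

/-- The state of all the qubits `Q` that is `ψ` on the qubits selected by `out` and `|0⟩` on all
the others. -/
noncomputable def embedState {m : ℕ} (out : Fin m ↪ Q) (ψ : QState (Fin m)) : QState Q :=
  open Classical in fun x => if ∀ q, q ∉ Set.range out → x q = false then ψ (x ∘ out) else 0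

/-- The circuit, started with all qubits in `|0⟩`, deterministically prepares `ψ` on the qubits
selected by `out`: whatever the measurement outcomes, the final state is `ψ` on these qubits and
`|0⟩` on all the others, up to a scalar (the global phase times the square root of the probability
of the branch). -/
def Prepares {m : ℕ} (A : HybridCircuit G) (out : Fin m ↪ Q) (ψ : QState (Fin m)) : Prop :=
  ∀ φ ∈ branches A (fun _ => false) (ket fun _ => false), ∃ c : ℂ, φ = c • embedState out ψ

end HybridCircuit

/-- The grid with `m` rows and `w` columns, in which the direct neighbours are adjacent. -/
abbrev gridGraph (m w : ℕ) : SimpleGraph (Fin m × Fin w) :=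
  (SimpleGraph.pathGraph m).boxProd (SimpleGraph.pathGraph w)

/-- A family of circuits, with the `n`-th one on a grid of `rows n × cols n` qubits, belongs to
`LAQCC = LAQCC(QNC⁰, NC¹, O(1))`: the number of rounds is bounded by a constant, the depth of
every quantum circuit is bounded by a constant, and the classical circuits have depth `O(log n)`
and size polynomial in `n`. -/
structure IsLAQCC {rows cols : ℕ → ℕ}
    (A : (n : ℕ) → HybridCircuit (gridGraph (rows n) (cols n))) : Prop where
  rounds : ∃ d : ℕ, ∀ n, (A n).length ≤ d
  quantum_depth : ∃ D : ℕ, ∀ n, ∀ R ∈ A n, R.quantum.length ≤ D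
  classical_depth : ∃ c : ℕ, ∀ n, ∀ R ∈ A n, ∀ i, (R.classical i).depth ≤ c * (Nat.log 2 n + 1)
  classical_size : ∃ c : ℕ, ∀ n, ∀ R ∈ A n, ∑ i, (R.classical i).size ≤ (n + 1) ^ c

/-- The state `|W⟩ = n^{-1/2} ∑ᵢ |eᵢ⟩` on `n` qubits. -/
noncomputable def wState (n : ℕ) : QState (Fin n) :=
  ((1 / Real.sqrt n : ℝ) : ℂ) • ∑ i : Fin n, ket fun j => decide (j = i)

/-!
Choose `θ` with `n sin² θ cos^{2(n-1)} θ = 1/4`. Rotating every qubit by `θ` gives a state whose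
part of Hamming weight one is `W / 2` up to sign, so that a single Grover iteration yields `W`
exactly. The iteration needs two reflections, about the strings of weight one and about the string
of weight zero.

To reflect about the strings of weight `t`, take `log₂ n + 1` auxiliary qubits. Between Hadamard
gates, the phases `exp (i π / 2 ^ j)` of the bits rotate the `j`-th of them to `|0⟩` if
`2 ^ (j + 1)` divides `weight x - t`, and to `|1⟩` if `2 ^ j` but not `2 ^ (j + 1)` does. Hence the
auxiliary qubits stay in `|0 ⋯ 0⟩` if `weight x = t`, and become orthogonal to it otherwise. A
reflection about `|0 ⋯ 0⟩`, followed by the inverse rotations, kicks the sign back to `x`. This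
reflection is a product of phases of the parities of all the subsets of the auxiliary qubits, of
which there are at most `2 n`.

Only phases of parities remain. In the grid, `x` is the first column, each auxiliary qubit is copied
along a column, and each row accumulates a running parity. These ancillas solve local linear
equations. So they can be created in constant depth: put them into a uniform superposition, measure
the equations, and correct the outcome by Pauli `X` gates. They are removed by measuring them in the
Hadamard basis, which leaves corrections by Pauli `Z` gates. The bits that control the corrections
are parities of outcomes, and these are in `NC¹`.
-/

/-! ### Parities -/

section Parity

variable {Q : Type}

instance xor_commutative : Std.Commutative xor := ⟨Bool.xor_comm⟩

instance xor_associative : Std.Associative xor := ⟨Bool.xor_assoc⟩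

/-- The parity of the bits of `x` at the positions in `S`. -/
def parity (S : Finset Q) (x : Q → Bool) : Bool := S.fold xor false x

/-- The sign `(-1)^b`. -/
def bsign (b : Bool) : ℂ := if b then -1 else 1

@[simp] theorem bsign_true : bsign true = -1 := rfl

@[simp] theorem bsign_false : bsign false = 1 := rfl

theorem bsign_xor (a b : Bool) : bsign (xor a b) = bsign a * bsign b := by
  cases a <;> cases b <;> simp

theorem bsign_mul_self (a : Bool) : bsign a * bsign a = 1 := by cases a <;> simp

theorem bsign_injective : Function.Injective bsign := by
  have neg_one_ne_one : (-1 : ℂ) ≠ 1 := by norm_num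
  rintro (_ | _) (_ | _) h
  · rfl
  · exact absurd h.symm neg_one_ne_one
  · exact absurd h neg_one_ne_one
  · rfl

@[simp] theorem parity_empty (x : Q → Bool) : parity ∅ x = false := rfl

@[simp] theorem parity_singleton (q : Q) (x : Q → Bool) : parity {q} x = x q := by
  simp [parity]

theorem parity_insert [DecidableEq Q] {S : Finset Q} {q : Q} (hq : q ∉ S) (x : Q → Bool) :
    parity (insert q S) x = xor (x q) (parity S x) :=
  Finset.fold_insert hq

theorem bsign_parity (S : Finset Q) (x : Q → Bool) :
    bsign (parity S x) = ∏ q ∈ S, bsign (x q) := by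
  classical
  induction S using Finset.induction_on with
  | empty => simp
  | insert a S ha ih => rw [Finset.prod_insert ha, ← ih, ← bsign_xor, parity_insert ha]

@[simp] theorem parity_const_false (S : Finset Q) : parity S (fun _ => false) = false :=
  bsign_injective (by simp [bsign_parity])

theorem parity_union [DecidableEq Q] {S T : Finset Q} (h : Disjoint S T) (x : Q → Bool) :
    parity (S ∪ T) x = xor (parity S x) (parity T x) := by
  apply bsign_injective
  simp only [bsign_xor, bsign_parity, Finset.prod_union h]

theorem parity_symmDiff [DecidableEq Q] (S T : Finset Q) (x : Q → Bool) :
    parity (symmDiff S T) x = xor (parity S x) (parity T x) := by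
  have hS := parity_union (Finset.disjoint_sdiff_inter S T) x
  have hT := parity_union (Finset.disjoint_sdiff_inter T S) x
  have hST : parity (symmDiff S T) x = xor (parity (S \ T) x) (parity (T \ S) x) :=
    parity_union disjoint_sdiff_sdiff x
  rw [Finset.sdiff_union_inter] at hS hT
  rw [Finset.inter_comm] at hT
  rw [hST, hS, hT]
  cases parity (S \ T) x <;> cases parity (T \ S) x <;> cases parity (S ∩ T) x <;> rfl

theorem parity_congr {S : Finset Q} {x y : Q → Bool} (h : ∀ q ∈ S, x q = y q) :
    parity S x = parity S y :=
  Finset.fold_congr h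

/-- Exchanging the order of summation in `∑ a, t a * ∑ q ∈ S a, x q`, written with signs. -/
theorem prod_bsign_and_parity {α : Type} [Fintype α] [Fintype Q] [DecidableEq Q]
    (S : α → Finset Q) (t : α → Bool) (x : Q → Bool) :
    ∏ a, bsign (t a && parity (S a) x) =
      ∏ q, bsign (x q && parity (Finset.univ.filter fun a => q ∈ S a) t) := by
  have expand_left : ∀ a, bsign (t a && parity (S a) x) =
      ∏ q, if q ∈ S a then bsign (t a && x q) else 1 := by
    intro a
    rw [← Finset.prod_filter, Finset.filter_mem_eq_inter, Finset.univ_inter]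
    cases t a <;> simp [bsign_parity]
  have expand_right : ∀ q, bsign (x q && parity (Finset.univ.filter fun a => q ∈ S a) t) =
      ∏ a, if q ∈ S a then bsign (t a && x q) else 1 := by
    intro q
    rw [← Finset.prod_filter]
    cases x q <;> simp [bsign_parity]
  simp only [expand_left, expand_right]
  exact Finset.prod_comm

end Parity

namespace BoolFormula

variable {α : Type}

/-- Exclusive or of two formulas, written with AND, OR and NOT. -/
def exclusiveOr (f g : BoolFormula α) : BoolFormula α := or (and f (not g)) (and (not f) g)

theorem eval_exclusiveOr (v : α → Bool) (f g : BoolFormula α) :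
    (exclusiveOr f g).eval v = xor (f.eval v) (g.eval v) := by
  simp only [exclusiveOr, eval]
  cases f.eval v <;> cases g.eval v <;> rfl

theorem depth_exclusiveOr_le (f g : BoolFormula α) :
    (exclusiveOr f g).depth ≤ max f.depth g.depth + 3 := by
  simp only [exclusiveOr, depth]
  omega

theorem size_lt_two_pow (f : BoolFormula α) : f.size < 2 ^ (f.depth + 1) := by
  induction f with
  | var a => simp [size, depth]
  | const b => simp [size, depth]
  | not f ih =>
    simp only [size, depth]
    rw [pow_succ]
    linarith [Nat.one_le_two_pow (n := f.depth + 1)]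
  | and f g ihf ihg | or f g ihf ihg =>
    simp only [size, depth]
    have hf : 2 ^ (f.depth + 1) ≤ 2 ^ (max f.depth g.depth + 1) :=
      Nat.pow_le_pow_right (by norm_num) (by omega)
    have hg : 2 ^ (g.depth + 1) ≤ 2 ^ (max f.depth g.depth + 1) :=
      Nat.pow_le_pow_right (by norm_num) (by omega)
    rw [pow_succ 2 (max f.depth g.depth + 1)]
    omega

theorem exists_eval_eq_parity {Q : Type} (u : Q → α) (k : ℕ) (S : Finset Q) (hS : S.card ≤ 2 ^ k) :
    ∃ f : BoolFormula α, f.depth ≤ 3 * k ∧ ∀ v, f.eval v = parity S fun q => v (u q) := by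
  classical
  induction k generalizing S with
  | zero =>
    rcases S.eq_empty_or_nonempty with rfl | hne
    · exact ⟨const false, by simp [depth], by simp [eval]⟩
    · obtain ⟨q, rfl⟩ := Finset.card_eq_one.1 (le_antisymm hS hne.card_pos)
      exact ⟨var (u q), by simp [depth], by simp [eval]⟩
  | succ k ih =>
    obtain ⟨T, hT, hc⟩ := Finset.exists_subset_card_eq (s := S) (n := min S.card (2 ^ k)) (by omega)
    obtain ⟨f, hf, hf'⟩ := ih T (by omega)
    obtain ⟨g, hg, hg'⟩ := ih (S \ T) (by
      rw [Finset.card_sdiff_of_subset hT, hc]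
      rw [pow_succ] at hS
      omega)
    refine ⟨exclusiveOr f g, (depth_exclusiveOr_le f g).trans (by omega), fun v => ?_⟩
    rw [eval_exclusiveOr, hf', hg', ← parity_union Finset.disjoint_sdiff,
      Finset.union_sdiff_of_subset hT]

end BoolFormula

/-! ### Tensor products of single-qubit operators -/

section TensorMatrix

open Matrix

variable {Q : Type}

theorem exists_ne_of_notMem_range_extend {ι : Type} {X : ι → Q} (hX : Function.Injective X)
    {x z : Q → Bool} (hz : z ∉ Set.range fun y => Function.extend X y x) :
    ∃ q, q ∉ Set.range X ∧ z q ≠ x q := by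
  by_contra! hc
  refine hz ⟨z ∘ X, funext fun q => ?_⟩
  by_cases hq : q ∈ Set.range X
  · obtain ⟨i, rfl⟩ := hq
    simp only [hX.extend_apply, Function.comp_apply]
  · simp only [Function.extend_apply' _ _ _ hq, hc q hq]

variable [Fintype Q]

/-- The tensor product of the single-qubit operators `W q`, in the computational basis. -/
def tensorMatrix (W : Q → Matrix Bool Bool ℂ) : Matrix (Q → Bool) (Q → Bool) ℂ :=
  Matrix.of fun x y => ∏ q, W q (x q) (y q)

theorem tensorMatrix_apply (W : Q → Matrix Bool Bool ℂ) (x y : Q → Bool) :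
    tensorMatrix W x y = ∏ q, W q (x q) (y q) := rfl

theorem tensorMatrix_diagonal (d : Q → Bool → ℂ) :
    tensorMatrix (fun q => diagonal (d q)) = diagonal fun x => ∏ q, d q (x q) := by
  classical
  ext x y
  rw [tensorMatrix_apply]
  by_cases hxy : x = y
  · simp [hxy]
  · obtain ⟨q, hq⟩ := Function.ne_iff.1 hxy
    exact (Finset.prod_eq_zero (Finset.mem_univ q) (diagonal_apply_ne (d q) hq)).trans
      (diagonal_apply_ne _ hxy).symm

theorem tensorMatrix_one : tensorMatrix (fun _ : Q => 1) = 1 := by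
  simpa using tensorMatrix_diagonal fun (_ : Q) _ => 1

variable [DecidableEq Q]

theorem tensorMatrix_mulVec (W : Q → Matrix Bool Bool ℂ) (ψ : QState Q) (x : Q → Bool) :
    (tensorMatrix W *ᵥ ψ) x = ∑ y, (∏ q, W q (x q) (y q)) * ψ y := rfl

theorem tensorMatrix_mul (W W' : Q → Matrix Bool Bool ℂ) :
    tensorMatrix W * tensorMatrix W' = tensorMatrix fun q => W q * W' q := by
  ext x z
  simp only [tensorMatrix_apply, mul_apply, Finset.prod_univ_sum, Fintype.piFinset_univ,
    Finset.prod_mul_distrib]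

theorem tensorMatrix_mulVec_eq_single (W : Q → Matrix Bool Bool ℂ) (ψ : QState Q) (x y : Q → Bool)
    (h : ∀ z, z ≠ y → (∃ q, W q (x q) (z q) = 0) ∨ ψ z = 0) :
    (tensorMatrix W *ᵥ ψ) x = (∏ q, W q (x q) (y q)) * ψ y := by
  rw [tensorMatrix_mulVec]
  refine Fintype.sum_eq_single y fun z hz => ?_
  rcases h z hz with ⟨q, hq⟩ | h
  · rw [Finset.prod_eq_zero (Finset.mem_univ q) hq, zero_mul]
  · rw [h, mul_zero]

theorem tensorMatrix_mulVec_of_injective {ι : Type} [Fintype ι] [DecidableEq ι] {X : ι → Q}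
    (hX : Function.Injective X) (W : Q → Matrix Bool Bool ℂ)
    (hW : ∀ q, q ∉ Set.range X → W q = 1) (ψ : QState Q) (x : Q → Bool) :
    (tensorMatrix W *ᵥ ψ) x =
      ∑ y, tensorMatrix (W ∘ X) (x ∘ X) y * ψ (Function.extend X y x) := by
  rw [tensorMatrix_mulVec]
  symm
  refine Fintype.sum_of_injective (fun y => Function.extend X y x)
    (fun y y' h => ?_) _ _ (fun z hz => ?_) (fun y => ?_)
  · simpa [Function.comp_def, hX.extend_apply] using congrArg (· ∘ X) h
  · obtain ⟨q, hq, hzq⟩ := exists_ne_of_notMem_range_extend hX hz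
    rw [Finset.prod_eq_zero (Finset.mem_univ q), zero_mul]
    rw [hW q hq, one_apply_ne hzq.symm]
  · congr 1
    refine Fintype.prod_of_injective X hX _ _ (fun q hq => ?_) (fun i => ?_)
    · rw [Function.extend_apply' _ _ _ hq, hW q hq, one_apply_eq]
    · rw [hX.extend_apply, Function.comp_apply, Function.comp_apply]

theorem tensorMatrix_update_mulVec (q : Q) (M : Matrix Bool Bool ℂ) (ψ : QState Q)
    (x : Q → Bool) :
    (tensorMatrix (Function.update (fun _ => 1) q M) *ᵥ ψ) x =
      ∑ b : Bool, M (x q) b * ψ (Function.update x q b) := by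
  have hq : Function.Injective fun _ : Unit => q := fun _ _ _ => rfl
  rw [tensorMatrix_mulVec_of_injective hq]
  · refine Fintype.sum_equiv (Equiv.funUnique Unit Bool) _ _ fun y => ?_
    congr 1
    · simp [tensorMatrix_apply]
    · congr 1
      funext p
      by_cases hp : p = q
      · subst hp
        rw [Function.update_self]
        exact hq.extend_apply y x ()
      · rw [Function.update_of_ne hp, Function.extend_apply']
        rintro ⟨_, h⟩
        exact hp h.symm
  · rintro p hp
    exact Function.update_of_ne (fun h => hp ⟨(), h.symm⟩) _ _

end TensorMatrix

/-! ### Quantum circuits of bounded depth -/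

section CNOTMap

variable {Q ι : Type}

open Classical in
/-- The action on strings of CNOT gates with controls `a i` and targets `b i`, for `i ∈ s`. -/
noncomputable def cnotMap (a b : ι → Q) (s : Set ι) (x : Q → Bool) : Q → Bool :=
  fun q => xor (x q) (decide (∃ i ∈ s, b i = q ∧ x (a i) = true))

variable {a b c : ι → Q} {s : Set ι}

theorem cnotMap_apply_target (hb : Set.InjOn b s) (x : Q → Bool) {i : ι} (hi : i ∈ s) :
    cnotMap a b s x (b i) = xor (x (b i)) (x (a i)) := by
  have flipped_iff : (∃ j ∈ s, b j = b i ∧ x (a j) = true) ↔ x (a i) = true :=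
    ⟨fun ⟨j, hj, h, h'⟩ => hb hj hi h ▸ h', fun h => ⟨i, hi, rfl, h⟩⟩
  simp [cnotMap, flipped_iff]

theorem cnotMap_apply_of_forall_ne (x : Q → Bool) {q : Q} (hq : ∀ i ∈ s, b i ≠ q) :
    cnotMap a b s x q = x q := by
  have not_flipped : ¬ ∃ j ∈ s, b j = q ∧ x (a j) = true := fun ⟨j, hj, h, _⟩ => hq j hj h
  simp [cnotMap, not_flipped]

theorem cnotMap_empty (x : Q → Bool) : cnotMap a b ∅ x = x :=
  funext fun _ => cnotMap_apply_of_forall_ne x (by simp)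

theorem cnotMap_insert [DecidableEq Q] {i : ι} (hb : Set.InjOn b (insert i s)) (x : Q → Bool) :
    cnotMap a b (insert i s) x =
      Function.update (cnotMap a b s x) (b i) (xor (x (b i)) (x (a i))) := by
  have hbs : Set.InjOn b s := hb.mono (Set.subset_insert i s)
  funext q
  by_cases hq : q = b i
  · rw [hq, Function.update_self, cnotMap_apply_target hb x (Set.mem_insert i s)]
  rw [Function.update_of_ne hq]
  by_cases hqs : ∃ j ∈ s, b j = q
  · obtain ⟨j, hj, rfl⟩ := hqs
    rw [cnotMap_apply_target hb x (Set.mem_insert_of_mem i hj), cnotMap_apply_target hbs x hj]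
  · push Not at hqs
    rw [cnotMap_apply_of_forall_ne x hqs, cnotMap_apply_of_forall_ne x]
    exact Set.forall_mem_insert.2 ⟨Ne.symm hq, hqs⟩

theorem cnotMap_commutator (hc : Set.InjOn c s) (hb : Set.InjOn b s)
    (hac : ∀ i ∈ s, ∀ j ∈ s, a i ≠ c j) (hab : ∀ i ∈ s, ∀ j ∈ s, a i ≠ b j)
    (hcb : ∀ i ∈ s, ∀ j ∈ s, c i ≠ b j) (x : Q → Bool) :
    cnotMap a c s (cnotMap c b s (cnotMap a c s (cnotMap c b s x))) = cnotMap a b s x := by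
  have a_of_cb : ∀ i ∈ s, ∀ x, cnotMap c b s x (a i) = x (a i) := fun i hi x =>
    cnotMap_apply_of_forall_ne x fun j hj => (hab i hi j hj).symm
  have a_of_ac : ∀ i ∈ s, ∀ x, cnotMap a c s x (a i) = x (a i) := fun i hi x =>
    cnotMap_apply_of_forall_ne x fun j hj => (hac i hi j hj).symm
  have c_of_cb : ∀ i ∈ s, ∀ x, cnotMap c b s x (c i) = x (c i) := fun i hi x =>
    cnotMap_apply_of_forall_ne x fun j hj => (hcb i hi j hj).symm
  have b_of_ac : ∀ i ∈ s, ∀ x, cnotMap a c s x (b i) = x (b i) := fun i hi x =>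
    cnotMap_apply_of_forall_ne x fun j hj => hcb j hj i hi
  funext q
  by_cases hqb : ∃ i ∈ s, b i = q
  · obtain ⟨i, hi, rfl⟩ := hqb
    simp only [b_of_ac i hi, cnotMap_apply_target hb _ hi, cnotMap_apply_target hc _ hi,
      c_of_cb i hi, a_of_cb i hi]
    cases x (b i) <;> cases x (c i) <;> cases x (a i) <;> rfl
  push Not at hqb
  have q_of_cb (x) : cnotMap c b s x q = x q := cnotMap_apply_of_forall_ne x hqb
  have q_of_ab (x) : cnotMap a b s x q = x q := cnotMap_apply_of_forall_ne x hqb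
  by_cases hqc : ∃ i ∈ s, c i = q
  · obtain ⟨i, hi, rfl⟩ := hqc
    simp only [q_of_cb, q_of_ab, cnotMap_apply_target hc _ hi, a_of_cb i hi, a_of_ac i hi]
    cases x (c i) <;> cases x (a i) <;> rfl
  · push Not at hqc
    have q_of_ac (x) : cnotMap a c s x q = x q := cnotMap_apply_of_forall_ne x hqc
    simp only [q_of_cb, q_of_ab, q_of_ac]

end CNOTMap

section ComputableInDepth

open Matrix

variable {Q : Type} [DecidableEq Q] {G : SimpleGraph Q} {k : ℕ}

theorem foldl_apply_cnot {ι : Type} {a b : ι → Q} (hadj : ∀ i, G.Adj (a i) (b i))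
    (y : Fin k → Bool) (l : List ι) (hl : l.Nodup) (hb : Set.InjOn b {i | i ∈ l})
    (hab : ∀ i ∈ l, ∀ j ∈ l, a i ≠ b j) (ψ : QState Q) :
    (l.map fun i => (⟨.cnot (a i) (b i) (hadj i), none⟩ : ControlledQGate G k)).foldl
      (fun φ g => g.apply y φ) ψ = ψ ∘ cnotMap a b {i | i ∈ l} := by
  induction l generalizing ψ with
  | nil => simp [Function.comp_def, cnotMap_empty]
  | cons i l ih =>
    have insert_eq : {j | j ∈ i :: l} = insert i {j | j ∈ l} := by ext; simp
    obtain ⟨hi, hl⟩ := List.nodup_cons.1 hl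
    rw [insert_eq] at hb ⊢
    rw [List.map_cons, List.foldl_cons, ih hl (hb.mono (Set.subset_insert _ _))
      (fun i hi j hj => hab i (List.mem_cons_of_mem _ hi) j (List.mem_cons_of_mem _ hj))]
    funext x
    have target : cnotMap a b {j | j ∈ l} x (b i) = x (b i) :=
      cnotMap_apply_of_forall_ne _ fun j hj h =>
        hi (hb (Set.mem_insert_of_mem _ hj) (Set.mem_insert _ _) h ▸ hj)
    have control : cnotMap a b {j | j ∈ l} x (a i) = x (a i) :=
      cnotMap_apply_of_forall_ne _ fun j hj =>
        (hab i List.mem_cons_self j (List.mem_cons_of_mem _ hj)).symm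
    simp only [Function.comp_apply, ControlledQGate.apply, QGate.apply, target, control]
    rw [cnotMap_insert hb]

variable [Fintype Q]

theorem ControlledQGate.apply_single (q : Q) (U : Matrix.unitaryGroup Bool ℂ)
    (ctrl : Option (Fin k)) (y : Fin k → Bool) (ψ : QState Q) :
    (⟨.single q U, ctrl⟩ : ControlledQGate G k).apply y ψ =
      tensorMatrix (Function.update (fun _ => 1) q (if ctrl.elim true y then U.1 else 1)) *ᵥ ψ := by
  funext x
  rw [tensorMatrix_update_mulVec]
  cases ctrl with
  | none => simp [ControlledQGate.apply, QGate.apply]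
  | some j =>
    by_cases hj : y j
    · simp [ControlledQGate.apply, QGate.apply, hj]
    · simp [ControlledQGate.apply, hj, one_apply]

theorem foldl_apply_single (U : Q → Matrix.unitaryGroup Bool ℂ) (ctrl : Q → Option (Fin k))
    (y : Fin k → Bool) (l : List Q) (hl : l.Nodup) (ψ : QState Q) :
    (l.map fun q => (⟨.single q (U q), ctrl q⟩ : ControlledQGate G k)).foldl
      (fun φ g => g.apply y φ) ψ =
    tensorMatrix (fun q => if q ∈ l then (if (ctrl q).elim true y then (U q).1 else 1) else 1)
      *ᵥ ψ := by
  induction l generalizing ψ with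
  | nil => simp [tensorMatrix_one]
  | cons q l ih =>
    obtain ⟨hq, hl⟩ := List.nodup_cons.1 hl
    rw [List.map_cons, List.foldl_cons, ih hl, ControlledQGate.apply_single, mulVec_mulVec,
      tensorMatrix_mul]
    congr 2
    funext p
    by_cases hp : p = q
    · simp [hp, hq]
    · simp [hp]

/-- The operation `T`, which depends on one classical control bit for every qubit, is carried out
by a quantum circuit of depth at most `D` on the connectivity graph `G`. -/
def ComputableInDepth (G : SimpleGraph Q) (D : ℕ) (T : (Q → Bool) → QState Q → QState Q) : Prop :=
  ∃ L : List (DepthOneLayer G (Fintype.card Q)), L.length ≤ D ∧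
    ∀ (y : Q → Bool) (ψ : QState Q),
      L.foldl (fun φ l => l.apply (fun i => y ((Fintype.equivFin Q).symm i)) φ) ψ = T y ψ

namespace ComputableInDepth

variable {D D' : ℕ} {T T' : (Q → Bool) → QState Q → QState Q}

theorem mono (h : ComputableInDepth G D T) (hD : D ≤ D') : ComputableInDepth G D' T := by
  obtain ⟨L, hL, h⟩ := h
  exact ⟨L, hL.trans hD, h⟩

theorem comp (h : ComputableInDepth G D T) (h' : ComputableInDepth G D' T') :
    ComputableInDepth G (D + D') fun y ψ => T' y (T y ψ) := by
  obtain ⟨L, hL, h⟩ := h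
  obtain ⟨L', hL', h'⟩ := h'
  refine ⟨L ++ L', by simp only [List.length_append]; omega, fun y ψ => ?_⟩
  rw [List.foldl_append, h, h']

theorem of_single (U : Q → Matrix.unitaryGroup Bool ℂ)
    (ctrl : Q → Option (Fin (Fintype.card Q))) :
    ComputableInDepth G 1 fun y ψ => tensorMatrix (fun q =>
      if (ctrl q).elim true fun i => y ((Fintype.equivFin Q).symm i) then (U q).1 else 1)
        *ᵥ ψ := by
  refine ⟨[⟨(Finset.univ : Finset Q).toList.map fun q => ⟨.single q (U q), ctrl q⟩, ?_⟩],
    by simp, fun y ψ => ?_⟩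
  · rw [List.pairwise_map]
    refine (Finset.nodup_toList _).imp fun h => ?_
    simpa [QGate.support] using h
  · simp only [List.foldl_cons, List.foldl_nil, DepthOneLayer.apply]
    rw [foldl_apply_single _ _ _ _ (Finset.nodup_toList _)]
    simp

theorem conditional (U : Q → Matrix.unitaryGroup Bool ℂ) :
    ComputableInDepth G 1 fun y ψ => tensorMatrix (fun q => if y q then (U q).1 else 1) *ᵥ ψ := by
  simpa using of_single (G := G) U fun q => some (Fintype.equivFin Q q)

theorem unconditional (U : Q → Matrix.unitaryGroup Bool ℂ) :
    ComputableInDepth G 1 fun _ ψ => tensorMatrix (fun q => (U q).1) *ᵥ ψ := by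
  simpa using of_single (G := G) U fun _ => none

variable {ι : Type} {a b c : ι → Q} {s : Set ι}

theorem cnot [Finite ι] (hadj : ∀ i ∈ s, G.Adj (a i) (b i)) (ha : Set.InjOn a s)
    (hb : Set.InjOn b s) (hab : ∀ i ∈ s, ∀ j ∈ s, a i ≠ b j) :
    ComputableInDepth G 1 fun _ ψ => ψ ∘ cnotMap a b s := by
  classical
  have := Fintype.ofFinite ι
  refine ⟨[⟨Finset.univ.toList.map fun i : s => ⟨.cnot (a i) (b i) (hadj i i.2), none⟩, ?_⟩],
    by simp, fun y ψ => ?_⟩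
  · rw [List.pairwise_map]
    refine (Finset.nodup_toList _).imp fun {i j} hij => ?_
    have a_ne : a i ≠ a j := fun h => hij (Subtype.ext (ha i.2 j.2 h))
    have b_ne : b i ≠ b j := fun h => hij (Subtype.ext (hb i.2 j.2 h))
    simp [QGate.support, a_ne.symm, b_ne.symm, hab j j.2 i i.2, (hab i i.2 j j.2).symm]
  · simp only [List.foldl_cons, List.foldl_nil, DepthOneLayer.apply]
    rw [foldl_apply_cnot (fun i : s => hadj i i.2) _ _ (Finset.nodup_toList _)
      (fun i _ j _ h => Subtype.ext (hb i.2 j.2 h)) (fun i _ j _ => hab _ i.2 _ j.2)]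
    refine congrArg (ψ ∘ ·) (funext fun x => funext fun q => ?_)
    simp [cnotMap, and_left_comm]

theorem cnot_trans (hac : ComputableInDepth G D fun _ ψ => ψ ∘ cnotMap a c s)
    (hcb : ComputableInDepth G D' fun _ ψ => ψ ∘ cnotMap c b s)
    (hc : Set.InjOn c s) (hb : Set.InjOn b s) (a_ne_c : ∀ i ∈ s, ∀ j ∈ s, a i ≠ c j)
    (a_ne_b : ∀ i ∈ s, ∀ j ∈ s, a i ≠ b j) (c_ne_b : ∀ i ∈ s, ∀ j ∈ s, c i ≠ b j) :
    ComputableInDepth G (2 * D + 2 * D') fun _ ψ => ψ ∘ cnotMap a b s := by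
  have commutator := cnotMap_commutator hc hb a_ne_c a_ne_b c_ne_b
  simpa only [Function.comp_def, commutator] using
    ((hac.comp hcb).comp (hac.comp hcb)).mono (D' := 2 * D + 2 * D') (by omega)

end ComputableInDepth

end ComputableInDepth

/-! ### Rounds and branches -/

namespace HybridCircuit

variable {Q : Type} [DecidableEq Q] {G : SimpleGraph Q} {d d' D b : ℕ}

theorem exists_mem_branches_of_append (A B : HybridCircuit G) (r : ℕ × Q → Bool) (ψ φ : QState Q)
    (h : φ ∈ branches (A ++ B) r ψ) :
    ∃ r', ∃ χ ∈ branches A r ψ, φ ∈ branches B r' χ := by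
  induction A generalizing r ψ with
  | nil => exact ⟨r, ψ, rfl, h⟩
  | cons R A ih =>
    simp only [List.cons_append, branches, Set.mem_iUnion] at h ⊢
    obtain ⟨o, h⟩ := h
    obtain ⟨r', χ, hχ, h⟩ := ih _ _ h
    exact ⟨r', χ, ⟨o, hχ⟩, h⟩

/-- The circuit has at most `d` rounds with quantum circuits of depth at most `D`, and classical
circuits no larger than those that compute, for each of `2 ^ b` qubits, a parity of `2 ^ b` bits. -/
structure Bounded (d D b : ℕ) (A : HybridCircuit G) : Prop where
  length_le : A.length ≤ d
  quantum_le : ∀ R ∈ A, R.quantum.length ≤ D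
  depth_le : ∀ R ∈ A, ∀ i, (R.classical i).depth ≤ 3 * b
  size_le : ∀ R ∈ A, ∑ i, (R.classical i).size ≤ 2 ^ (4 * b + 1)

theorem Bounded.append {A B : HybridCircuit G} (hA : Bounded d D b A) (hB : Bounded d' D b B) :
    Bounded (d + d') D b (A ++ B) where
  length_le := by
    rw [List.length_append]
    exact Nat.add_le_add hA.length_le hB.length_le
  quantum_le R hR := (List.mem_append.1 hR).elim (hA.quantum_le R) (hB.quantum_le R)
  depth_le R hR := (List.mem_append.1 hR).elim (hA.depth_le R) (hB.depth_le R)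
  size_le R hR := (List.mem_append.1 hR).elim (hA.size_le R) (hB.size_le R)

theorem bounded_nil : Bounded d D b ([] : HybridCircuit G) where
  length_le := Nat.zero_le d
  quantum_le := by simp
  depth_le := by simp
  size_le := by simp

end HybridCircuit

section Round

variable {Q : Type} [DecidableEq Q] {G : SimpleGraph Q}

/-- The unnormalized state after the qubits in `M` have been measured with outcome `s`; only the
values of `s` on `M` matter. -/
def projectOn (M : Finset Q) (s : Q → Bool) (ψ : QState Q) : QState Q :=
  fun x => if ∀ q ∈ M, x q = s q then ψ x else 0

theorem HybridRound.project_eq_projectOn (R : HybridRound G) (o : R.measured → Bool)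
    (r : ℕ × Q → Bool) (ψ : QState Q) :
    R.project o ψ = projectOn R.measured (fun q => R.pushRecord o r (0, q)) ψ := by
  funext x
  have agree_iff : (∀ q : R.measured, x q = o q) ↔
      ∀ q ∈ R.measured, x q = R.pushRecord o r (0, q) :=
    ⟨fun h q hq => by simp [pushRecord, hq, h ⟨q, hq⟩], fun h q => by
      simp [h q.1 q.2, pushRecord]⟩
  simp only [project, projectOn, agree_iff]

theorem BoolFormula.sum_size_le_of_depth_le {α ι : Type} [Fintype ι] {b : ℕ}
    (hι : Fintype.card ι ≤ 2 ^ b) (f : ι → BoolFormula α) (hf : ∀ i, (f i).depth ≤ 3 * b) :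
    ∑ i, (f i).size ≤ 2 ^ (4 * b + 1) :=
  calc ∑ i, (f i).size
      ≤ ∑ _i : ι, 2 ^ (3 * b + 1) := Finset.sum_le_sum fun i _ =>
        (size_lt_two_pow _).le.trans
          (Nat.pow_le_pow_right two_pos (Nat.add_le_add_right (hf i) 1))
    _ = Fintype.card ι * 2 ^ (3 * b + 1) := by simp
    _ ≤ 2 ^ b * 2 ^ (3 * b + 1) := Nat.mul_le_mul_right _ hι
    _ = 2 ^ (4 * b + 1) := by rw [← pow_add]; congr 1; ring

/-- The record `r'` holds the outcomes of the new measurement. The control bit of `q` is the parity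
of the previous outcomes in `S q`. -/
theorem exists_parity_round [Fintype Q] {D b : ℕ} (hQ : Fintype.card Q ≤ 2 ^ b)
    (S : Q → Finset Q) {T : (Q → Bool) → QState Q → QState Q} (hT : ComputableInDepth G D T)
    (M : Finset Q) :
    ∃ R : HybridRound G, HybridCircuit.Bounded 1 D b [R] ∧ ∀ (A : HybridCircuit G) r ψ φ,
      φ ∈ HybridCircuit.branches (R :: A) r ψ →
      ∃ r', φ ∈ HybridCircuit.branches A r' (projectOn M (fun q => r' (0, q))
        (T (fun q => parity (S q) fun p => r (0, p)) ψ)) := by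
  obtain ⟨L, hL, hT⟩ := hT
  choose f f_depth eval_f using fun q =>
    BoolFormula.exists_eval_eq_parity (fun p : Q => (0, p)) b (S q)
      ((Finset.card_le_univ _).trans hQ)
  let R : HybridRound G := ⟨Fintype.card Q, fun i => f ((Fintype.equivFin Q).symm i), L, M⟩
  refine ⟨R, ⟨by simp, by simpa using hL, by simpa using fun i => f_depth _, ?_⟩, ?_⟩
  · simpa using BoolFormula.sum_size_le_of_depth_le (by simpa using hQ) _ fun i => f_depth _
  · intro A r ψ φ h
    simp only [HybridCircuit.branches, Set.mem_iUnion] at h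
    obtain ⟨o, h⟩ := h
    rw [R.project_eq_projectOn o r] at h
    refine ⟨R.pushRecord o r, ?_⟩
    rw [← hT]
    simpa only [HybridRound.applyQuantum, R, eval_f] using h

end Round

/-! ### Single-qubit gates -/

section Gates

open Matrix

/-- The Hadamard gate as a matrix, for use in `tensorMatrix`. -/
noncomputable def hadamardMatrix : Matrix Bool Bool ℂ :=
  Matrix.of fun a b => ((Real.sqrt 2)⁻¹ : ℝ) * bsign (a && b)

theorem inv_sqrt_two_mul_self :
    (((Real.sqrt 2)⁻¹ : ℝ) : ℂ) * (((Real.sqrt 2)⁻¹ : ℝ) : ℂ) = 1 / 2 := by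
  rw [← Complex.ofReal_mul, ← mul_inv, Real.mul_self_sqrt (by norm_num)]
  norm_num

theorem hadamardMatrix_mul_self : hadamardMatrix * hadamardMatrix = 1 := by
  have h := inv_sqrt_two_mul_self
  ext a b
  rw [mul_apply, Fintype.sum_bool]
  cases a <;> cases b <;> simp [hadamardMatrix] at h ⊢ <;> linear_combination 2 * h

theorem star_hadamardMatrix : star hadamardMatrix = hadamardMatrix := by
  ext a b
  cases a <;> cases b <;> simp [hadamardMatrix, star_apply]

/-- The Hadamard gate. -/
noncomputable def hadamardGate : Matrix.unitaryGroup Bool ℂ :=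
  ⟨hadamardMatrix, mem_unitaryGroup_iff.2 (by rw [star_hadamardMatrix, hadamardMatrix_mul_self])⟩

/-- The Pauli `X` gate as a matrix, for use in `tensorMatrix`. -/
def flipMatrix : Matrix Bool Bool ℂ := Matrix.of fun a b => if a = b then 0 else 1

/-- The Pauli `X` gate. -/
def flipGate : Matrix.unitaryGroup Bool ℂ :=
  ⟨flipMatrix, mem_unitaryGroup_iff.2 (by
    ext a b
    rw [mul_apply, Fintype.sum_bool]
    cases a <;> cases b <;> simp [flipMatrix, star_apply])⟩

/-- The phase `exp (i θ b)` that the phase gate with angle `θ` gives to the basis state `|b⟩`. -/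
noncomputable def phase (θ : ℝ) (b : Bool) : ℂ := if b then Complex.exp (θ * Complex.I) else 1

@[simp] theorem phase_false (θ : ℝ) : phase θ false = 1 := rfl

theorem phase_true (θ : ℝ) : phase θ true = Complex.exp (θ * Complex.I) := rfl

@[simp] theorem phase_zero (b : Bool) : phase 0 b = 1 := by cases b <;> simp [phase]

theorem phase_pi (b : Bool) : phase Real.pi b = bsign b := by
  cases b <;> simp [phase, bsign]

theorem phase_mul_star (θ : ℝ) (b : Bool) : phase θ b * star (phase θ b) = 1 := by
  cases b
  · simp
  · rw [phase_true, Complex.star_def, ← Complex.exp_conj, ← Complex.exp_add]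
    simp

/-- The phase gate with angle `θ`. -/
noncomputable def phaseGate (θ : ℝ) : Matrix.unitaryGroup Bool ℂ :=
  ⟨diagonal (phase θ), mem_unitaryGroup_iff.2 (by
    rw [star_eq_conjTranspose, diagonal_conjTranspose, diagonal_mul_diagonal]
    simp only [Pi.star_apply, phase_mul_star]
    exact diagonal_one)⟩

end Gates

/-! ### Parity codes -/

section ParityCode

open Matrix

variable {Q : Type}

/-- A parity code: in a code word every ancilla `a` in `anc` holds the parity of the bits in
`supp a`, and the check qubits `chk` hold zeros. -/
structure ParityCode (Q : Type) where
  anc : Finset Q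
  chk : Finset Q
  supp : Q → Finset Q
  notMem_chk_of_mem_anc : ∀ q ∈ anc, q ∉ chk
  supp_eq_empty : ∀ q ∉ anc, supp q = ∅
  notMem_anc_of_mem_supp : ∀ a, ∀ q ∈ supp a, q ∉ anc
  notMem_chk_of_mem_supp : ∀ a, ∀ q ∈ supp a, q ∉ chk

/-- The string `x` is a code word of the code `K`. -/
structure ParityCode.IsCodeword (K : ParityCode Q) (x : Q → Bool) : Prop where
  chk_eq_false : ∀ q ∈ K.chk, x q = false
  anc_eq_parity : ∀ a ∈ K.anc, x a = parity (K.supp a) x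

/-- The function `f` on strings without ones in `C` is a parity of the bits of `V x` in `C` and the
bits of `x` outside `F` and `C`. This makes it possible to compute `f` after measuring `C`. -/
def IsRecoverable (F C : Finset Q) (V : (Q → Bool) → Q → Bool) (f : (Q → Bool) → Bool) : Prop :=
  ∃ S E : Finset Q, (∀ q ∈ S, q ∉ F ∧ q ∉ C) ∧ E ⊆ C ∧
    ∀ x, (∀ q ∈ C, x q = false) → f x = xor (parity S x) (parity E (V x))

/-- A parity code with an involution `toFun` on strings that changes only the check bits. Measuring
the check qubits after `toFun` gives an outcome `s`, and the ancilla `a` then differs from the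
parity of `supp a` by the parity of `s` on `synd a`. -/
structure ParityEncoder (Q : Type) extends ParityCode Q where
  toFun : (Q → Bool) → Q → Bool
  synd : Q → Finset Q
  card_chk_le : chk.card ≤ anc.card
  toFun_toFun : ∀ x, toFun (toFun x) = x
  toFun_of_notMem : ∀ x, ∀ q ∉ chk, toFun x q = x q
  synd_eq_empty : ∀ q ∉ anc, synd q = ∅
  synd_subset : ∀ q, synd q ⊆ chk
  anc_eq : ∀ a ∈ anc, ∀ x, (∀ q ∈ chk, x q = false) →
    x a = xor (parity (supp a) x) (parity (synd a) (toFun x))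

instance : CoeFun (ParityEncoder Q) fun _ => (Q → Bool) → Q → Bool := ⟨ParityEncoder.toFun⟩

theorem ParityEncoder.exists_of_isRecoverable {F C : Finset Q} {V : (Q → Bool) → Q → Bool}
    (hFC : ∀ q ∈ F, q ∉ C) (hcard : C.card ≤ F.card) (hV : ∀ x, V (V x) = x)
    (hVC : ∀ x, ∀ q ∉ C, V x q = x q) (hF : ∀ a ∈ F, IsRecoverable F C V fun x => x a) :
    ∃ K : ParityEncoder Q, K.anc = F ∧ K.chk = C ∧ K.toFun = V := by
  classical
  choose! S E hS hE hSE using hF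
  have mem_supp {a q} (h : q ∈ if a ∈ F then S a else ∅) : q ∉ F ∧ q ∉ C := by
    split_ifs at h with ha
    · exact hS a ha q h
    · exact absurd h (Finset.notMem_empty q)
  refine ⟨⟨⟨F, C, fun a => if a ∈ F then S a else ∅, hFC, fun q hq => if_neg hq,
    fun a q hq => (mem_supp hq).1, fun a q hq => (mem_supp hq).2⟩, V,
    fun a => if a ∈ F then E a else ∅, hcard, hV, hVC, fun q hq => if_neg hq, fun a => ?_,
    fun a ha x hx => ?_⟩, rfl, rfl, rfl⟩
  · split_ifs with ha
    · exact hE a ha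
    · exact Finset.empty_subset C
  · simpa only [if_pos ha] using hSE a ha x hx

theorem ParityCode.parity_supp_congr {K : ParityCode Q} {x y : Q → Bool}
    (h : ∀ q, q ∉ K.anc → q ∉ K.chk → x q = y q) (a : Q) :
    parity (K.supp a) x = parity (K.supp a) y :=
  parity_congr fun q hq => h q (K.notMem_anc_of_mem_supp a q hq) (K.notMem_chk_of_mem_supp a q hq)

/-- By counting: different values of the ancillas lead to different check bits, and there are at
least as many ancillas as check qubits. -/
theorem ParityEncoder.exists_eq_on_chk {K : ParityEncoder Q} {x : Q → Bool}
    (hx : ∀ q ∈ K.chk, x q = false) (s : Q → Bool) :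
    ∃ y, (∀ q ∉ K.anc, y q = x q) ∧ ∀ q ∈ K.chk, K y q = s q := by
  classical
  let y (u : K.anc → Bool) : Q → Bool := Function.extend Subtype.val u x
  have y_anc (u) (a : K.anc) : y u a = u a := Subtype.val_injective.extend_apply u x a
  have y_of_notMem (u) (q) (hq : q ∉ K.anc) : y u q = x q :=
    Function.extend_apply' u x q fun ⟨a, ha⟩ => hq (ha ▸ a.2)
  have y_chk (u) (q) (hq : q ∈ K.chk) : y u q = false := by
    rw [y_of_notMem u q fun h => K.notMem_chk_of_mem_anc q h hq, hx q hq]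
  have injective : Function.Injective fun (u : K.anc → Bool) (c : K.chk) => K (y u) c := by
    intro u v huv
    funext a
    rw [← y_anc u, ← y_anc v, K.anc_eq a a.2 _ (y_chk u), K.anc_eq a a.2 _ (y_chk v)]
    congr 1
    · exact ParityCode.parity_supp_congr
        (fun q hq _ => (y_of_notMem u q hq).trans (y_of_notMem v q hq).symm) a
    · exact parity_congr fun q hq => congrFun huv ⟨q, K.synd_subset a hq⟩
  have card_le : Nat.card (K.chk → Bool) ≤ Nat.card (K.anc → Bool) := by
    simpa using Nat.pow_le_pow_right two_pos K.card_chk_le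
  obtain ⟨u, hu⟩ := (injective.bijective_of_nat_card_le card_le).surjective fun c => s c
  exact ⟨y u, y_of_notMem u, fun q hq => congrFun hu ⟨q, hq⟩⟩

variable [DecidableEq Q]

/-- The string `x` with the bits in `F` set to zero. -/
def clear (F : Finset Q) (x : Q → Bool) : Q → Bool := fun q => if q ∈ F then false else x q

theorem clear_of_mem {F : Finset Q} {q : Q} (hq : q ∈ F) (x : Q → Bool) : clear F x q = false :=
  if_pos hq

theorem clear_of_notMem {F : Finset Q} {q : Q} (hq : q ∉ F) (x : Q → Bool) : clear F x q = x q :=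
  if_neg hq

theorem clear_congr {F : Finset Q} {x y : Q → Bool} (h : ∀ q ∉ F, x q = y q) :
    clear F x = clear F y := by
  funext q
  by_cases hq : q ∈ F
  · rw [clear_of_mem hq, clear_of_mem hq]
  · rw [clear_of_notMem hq, clear_of_notMem hq, h q hq]

theorem clear_eq_self {F : Finset Q} {x : Q → Bool} (h : ∀ q ∈ F, x q = false) :
    clear F x = x := by
  funext q
  by_cases hq : q ∈ F
  · rw [clear_of_mem hq, h q hq]
  · rw [clear_of_notMem hq]

/-- The state `ψ` has all qubits in `M` in the state `|0⟩`. -/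
def IsBlankOn (M : Finset Q) (ψ : QState Q) : Prop := ∀ x, ∀ q ∈ M, x q = true → ψ x = 0

omit [DecidableEq Q] in
theorem IsBlankOn.mul {M : Finset Q} {ψ : QState Q} (hψ : IsBlankOn M ψ) (Φ : (Q → Bool) → ℂ) :
    IsBlankOn M fun x => Φ x * ψ x :=
  fun x q hq hx => mul_eq_zero_of_right (Φ x) (hψ x q hq hx)

namespace ParityCode

variable (K : ParityCode Q)

open Classical in
/-- The state obtained from `ψ` by replacing the ancillas and the check qubits so as to turn every
basis state into a code word. -/
noncomputable def encode (ψ : QState Q) : QState Q :=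
  fun x => if K.IsCodeword x then ψ (clear K.anc x) else 0

theorem mul_encode {Ψ Φ : (Q → Bool) → ℂ} (h : ∀ x, K.IsCodeword x → Ψ x = Φ (clear K.anc x))
    (ψ : QState Q) : (fun x => Ψ x * K.encode ψ x) = K.encode fun x => Φ x * ψ x := by
  funext x
  by_cases hx : K.IsCodeword x
  · simp only [encode, if_pos hx, h x hx]
  · simp only [encode, if_neg hx, mul_zero]

/-- The string `x` with the correct parities in the ancillas. -/
def writeParities (x : Q → Bool) : Q → Bool :=
  fun q => if q ∈ K.anc then parity (K.supp q) x else x q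

variable {K}

theorem writeParities_of_notMem {q : Q} (hq : q ∉ K.anc) (x : Q → Bool) :
    K.writeParities x q = x q := if_neg hq

theorem writeParities_of_mem {a : Q} (ha : a ∈ K.anc) (x : Q → Bool) :
    K.writeParities x a = parity (K.supp a) x := if_pos ha

theorem isCodeword_writeParities {x : Q → Bool} (hx : ∀ q ∈ K.chk, x q = false) :
    K.IsCodeword (K.writeParities x) where
  chk_eq_false q hq := by
    rw [writeParities_of_notMem fun h => K.notMem_chk_of_mem_anc q h hq, hx q hq]
  anc_eq_parity a ha := by
    rw [writeParities_of_mem ha]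
    exact parity_supp_congr (fun q hq _ => (writeParities_of_notMem hq x).symm) a

theorem IsCodeword.eq_writeParities {x z : Q → Bool} (hz : K.IsCodeword z)
    (hzx : ∀ q ∉ K.anc, z q = x q) : z = K.writeParities x := by
  funext q
  by_cases hq : q ∈ K.anc
  · rw [hz.anc_eq_parity q hq, writeParities_of_mem hq]
    exact parity_supp_congr (fun q hq _ => hzx q hq) q
  · rw [hzx q hq, writeParities_of_notMem hq]

theorem encode_writeParities {ψ : QState Q} (hψ : IsBlankOn K.chk ψ) (x : Q → Bool) :
    K.encode ψ (K.writeParities x) = ψ (clear K.anc x) := by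
  have clear_eq : clear K.anc (K.writeParities x) = clear K.anc x :=
    clear_congr fun q hq => writeParities_of_notMem hq x
  by_cases hx : ∀ q ∈ K.chk, x q = false
  · rw [encode, if_pos (isCodeword_writeParities hx), clear_eq]
  · push Not at hx
    obtain ⟨q, hq, hxq⟩ := hx
    have hqa : q ∉ K.anc := fun h => K.notMem_chk_of_mem_anc q h hq
    rw [encode, if_neg, hψ _ q hq]
    · simpa [clear_of_notMem hqa] using hxq
    · intro h
      exact hxq (by rw [← writeParities_of_notMem hqa x, h.chk_eq_false q hq])

end ParityCode

namespace ParityEncoder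

variable {K : ParityEncoder Q}

variable (K) in
/-- The qubit `q` is flipped if the parity of the measured bits in this set is odd. -/
def flipControl (q : Q) : Finset Q := if q ∈ K.chk then {q} else K.synd q

theorem parity_flipControl_of_mem_chk {q : Q} (hq : q ∈ K.chk) (s : Q → Bool) :
    parity (K.flipControl q) s = s q := by
  rw [flipControl, if_pos hq, parity_singleton]

theorem parity_flipControl_of_mem_anc {q : Q} (hq : q ∈ K.anc) (s : Q → Bool) :
    parity (K.flipControl q) s = parity (K.synd q) s := by
  rw [flipControl, if_neg (K.notMem_chk_of_mem_anc q hq)]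

theorem parity_flipControl_of_notMem {q : Q} (ha : q ∉ K.anc) (hc : q ∉ K.chk) (s : Q → Bool) :
    parity (K.flipControl q) s = false := by
  rw [flipControl, if_neg hc, K.synd_eq_empty q ha, parity_empty]

theorem chk_eq_false_iff {x x' : Q → Bool} (hx : ∀ q ∈ K.chk, x q = false) (s : Q → Bool)
    (hx' : ∀ q, x' q = xor (x q) (parity (K.flipControl q) s)) :
    (∀ q ∈ K.chk, K x' q = false) ↔ K.IsCodeword x := by
  have x'_anc (a) (ha : a ∈ K.anc) : x' a = xor (x a) (parity (K.synd a) s) := by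
    rw [hx', parity_flipControl_of_mem_anc ha]
  have x'_chk (q) (hq : q ∈ K.chk) : x' q = s q := by
    rw [hx', parity_flipControl_of_mem_chk hq, hx q hq, Bool.false_xor]
  have x'_of_notMem (q) (ha : q ∉ K.anc) (hc : q ∉ K.chk) : x' q = x q := by
    rw [hx', parity_flipControl_of_notMem ha hc, Bool.xor_false]
  constructor
  · intro hV
    refine ⟨hx, fun a ha => ?_⟩
    have recover := K.anc_eq a ha _ hV
    have supp_eq : parity (K.supp a) (K x') = parity (K.supp a) x :=
      ParityCode.parity_supp_congr (fun q ha hc => by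
        rw [K.toFun_of_notMem _ q hc, x'_of_notMem q ha hc]) a
    have synd_eq : parity (K.synd a) x' = parity (K.synd a) s :=
      parity_congr fun q hq => x'_chk q (K.synd_subset a hq)
    rw [K.toFun_toFun, K.toFun_of_notMem _ a (K.notMem_chk_of_mem_anc a ha), x'_anc a ha, supp_eq,
      synd_eq] at recover
    simpa using recover
  · intro hcode
    obtain ⟨y, hyx, hy⟩ := K.exists_eq_on_chk hx s
    have y_chk (q) (hq : q ∈ K.chk) : y q = false := by
      rw [hyx q fun h => K.notMem_chk_of_mem_anc q h hq, hx q hq]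
    have K_y : K y = x' := by
      funext q
      by_cases hc : q ∈ K.chk
      · rw [hy q hc, x'_chk q hc]
      rw [K.toFun_of_notMem y q hc]
      by_cases ha : q ∈ K.anc
      · rw [x'_anc q ha, K.anc_eq q ha y y_chk, hcode.anc_eq_parity q ha,
          ParityCode.parity_supp_congr (fun q ha _ => hyx q ha) q,
          parity_congr fun p hp => hy p (K.synd_subset q hp)]
      · rw [hyx q ha, x'_of_notMem q ha hc]
    intro q hq
    rw [← K_y, K.toFun_toFun, y_chk q hq]

omit [DecidableEq Q] in
theorem chk_apply_eq_false_of_isCodeword {x : Q → Bool} (hx : K.IsCodeword x) :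
    ∀ q ∈ K.chk, K x q = false := by
  classical
  exact (chk_eq_false_iff hx.chk_eq_false (fun _ => false) (by simp)).2 hx

end ParityEncoder

end ParityCode

/-! ### Encoding by measurements -/

section Correction

open Matrix

variable {Q : Type} [Fintype Q] [DecidableEq Q]

/-- Hadamard gates on the qubits in `F`. -/
noncomputable def hadamardOn (F : Finset Q) (q : Q) : Matrix.unitaryGroup Bool ℂ :=
  if q ∈ F then hadamardGate else 1

/-- The Pauli corrections: `X` on the qubits in `M` and `Z` on the others. -/
noncomputable def pauliOn (M : Finset Q) (q : Q) : Matrix.unitaryGroup Bool ℂ :=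
  if q ∈ M then flipGate else phaseGate Real.pi

theorem pauliOn_mulVec (M : Finset Q) (b : Q → Bool) (ψ : QState Q) (x : Q → Bool) :
    (tensorMatrix (fun q => if b q then (pauliOn M q).1 else 1) *ᵥ ψ) x =
      (∏ q, if q ∈ M then 1 else bsign (x q && b q)) *
        ψ (fun q => if q ∈ M then xor (x q) (b q) else x q) := by
  rw [tensorMatrix_mulVec_eq_single _ _ x fun q => if q ∈ M then xor (x q) (b q) else x q]
  · congr 1
    refine Finset.prod_congr rfl fun q _ => ?_
    by_cases hq : q ∈ M
    · cases b q <;> cases x q <;> simp [pauliOn, hq, flipGate, flipMatrix, one_apply]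
    · cases b q <;> cases x q <;> simp [pauliOn, hq, phaseGate, phase_pi, one_apply]
  · intro z hz
    obtain ⟨q, hq⟩ := Function.ne_iff.1 hz
    refine Or.inl ⟨q, ?_⟩
    by_cases hqM : q ∈ M
    · cases hb : b q <;> cases hx : x q <;> cases hz : z q <;>
        simp_all [pauliOn, flipGate, flipMatrix]
    · cases hb : b q <;> cases hx : x q <;> cases hz : z q <;>
        simp_all [pauliOn, phaseGate]

theorem hadamardOn_mulVec_of_isBlankOn {F : Finset Q} {ψ : QState Q} (hψ : IsBlankOn F ψ)
    (x : Q → Bool) :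
    (tensorMatrix (fun q => (hadamardOn F q).1) *ᵥ ψ) x =
      (((Real.sqrt 2)⁻¹ : ℝ) : ℂ) ^ F.card * ψ (clear F x) := by
  rw [tensorMatrix_mulVec_eq_single _ _ x (clear F x)]
  · congr 1
    rw [← Finset.prod_const, ← Finset.prod_subset (Finset.subset_univ F)]
    · refine Finset.prod_congr rfl fun q hq => ?_
      simp [hadamardOn, hq, clear_of_mem, hadamardGate, hadamardMatrix]
    · intro q _ hq
      simp [hadamardOn, hq, clear_of_notMem]
  · intro z hz
    obtain ⟨q, hq⟩ := Function.ne_iff.1 hz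
    by_cases hqF : q ∈ F
    · exact Or.inr (hψ z q hqF (by simpa [clear_of_mem hqF] using hq))
    · rw [clear_of_notMem hqF] at hq
      exact Or.inl ⟨q, by simp [hadamardOn, hqF, one_apply_ne hq.symm]⟩

namespace ParityEncoder

variable {K : ParityEncoder Q}

theorem pauliOn_flipControl_mulVec (s : Q → Bool) (ψ : QState Q) (x : Q → Bool) :
    (tensorMatrix (fun q =>
      if parity (K.flipControl q) s then (pauliOn (K.anc ∪ K.chk) q).1 else 1) *ᵥ ψ) x =
      ψ fun q => xor (x q) (parity (K.flipControl q) s) := by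
  have flipControl_eq_false (q) (hq : q ∉ K.anc ∪ K.chk) : parity (K.flipControl q) s = false :=
    parity_flipControl_of_notMem (fun h => hq (Finset.mem_union_left _ h))
      (fun h => hq (Finset.mem_union_right _ h)) s
  rw [pauliOn_mulVec, Finset.prod_eq_one, one_mul]
  · congr 1
    funext q
    split_ifs with hq
    · rfl
    · rw [flipControl_eq_false q hq, Bool.xor_false]
  · intro q _
    split_ifs with hq
    · rfl
    · rw [flipControl_eq_false q hq, Bool.and_false, bsign_false]

theorem pauliOn_projectOn_hadamardOn {ψ : QState Q} (hanc : IsBlankOn K.anc ψ)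
    (hchk : IsBlankOn K.chk ψ) (s : Q → Bool) :
    tensorMatrix (fun q => if parity (K.flipControl q) s then (pauliOn (K.anc ∪ K.chk) q).1 else 1)
        *ᵥ projectOn K.chk s ((tensorMatrix (fun q => (hadamardOn K.anc q).1) *ᵥ ψ) ∘ K) =
      (((Real.sqrt 2)⁻¹ : ℝ) : ℂ) ^ K.anc.card • K.encode ψ := by
  funext x
  rw [pauliOn_flipControl_mulVec, projectOn, Function.comp_apply,
    hadamardOn_mulVec_of_isBlankOn hanc, Pi.smul_apply, smul_eq_mul, ParityCode.encode]
  set x' : Q → Bool := fun q => xor (x q) (parity (K.flipControl q) s) with hx'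
  have agree_iff : (∀ q ∈ K.chk, xor (x q) (parity (K.flipControl q) s) = s q) ↔
      ∀ q ∈ K.chk, x q = false :=
    forall₂_congr fun q hq => by
      rw [parity_flipControl_of_mem_chk hq]
      cases x q <;> simp
  simp only [agree_iff]
  by_cases hx : ∀ q ∈ K.chk, x q = false
  swap
  · rw [if_neg hx, if_neg fun h => hx h.chk_eq_false, mul_zero]
  have chk_iff := chk_eq_false_iff (x' := x') hx s fun _ => rfl
  rw [if_pos hx]
  by_cases hcode : K.IsCodeword x
  · rw [if_pos hcode, clear_congr fun q ha => ?_]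
    by_cases hc : q ∈ K.chk
    · rw [chk_iff.2 hcode q hc, hx q hc]
    · simp only [K.toFun_of_notMem _ q hc, hx', parity_flipControl_of_notMem ha hc, Bool.xor_false]
  · obtain ⟨q, hq, hxq⟩ : ∃ q ∈ K.chk, K x' q ≠ false := by
      by_contra! h
      exact hcode (chk_iff.1 h)
    rw [if_neg hcode, hchk _ q hq, mul_zero]
    rw [clear_of_notMem fun h => K.notMem_chk_of_mem_anc q h hq]
    simpa using hxq

end ParityEncoder

namespace ParityCode

variable {K : ParityCode Q}

theorem hadamardOn_encode {ψ : QState Q} (hψ : IsBlankOn K.chk ψ) (x : Q → Bool) :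
    (tensorMatrix (fun q => (hadamardOn K.anc q).1) *ᵥ K.encode ψ) x =
      (((Real.sqrt 2)⁻¹ : ℝ) : ℂ) ^ K.anc.card *
        (∏ q, bsign (x q && parity (K.supp q) x)) * ψ (clear K.anc x) := by
  rw [tensorMatrix_mulVec_eq_single _ _ x (K.writeParities x), encode_writeParities hψ]
  · congr 1
    have entry (q) : (hadamardOn K.anc q).1 (x q) (K.writeParities x q) =
        (if q ∈ K.anc then (((Real.sqrt 2)⁻¹ : ℝ) : ℂ) else 1) *
          bsign (x q && parity (K.supp q) x) := by
      by_cases hq : q ∈ K.anc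
      · simp [hadamardOn, hq, writeParities_of_mem, hadamardGate, hadamardMatrix]
      · simp [hadamardOn, hq, writeParities_of_notMem, K.supp_eq_empty]
    simp only [entry, Finset.prod_mul_distrib, Finset.prod_ite_mem, Finset.univ_inter,
      Finset.prod_const]
  · intro z hz
    by_cases hcode : K.IsCodeword z
    · obtain ⟨q, hq, hzq⟩ : ∃ q, q ∉ K.anc ∧ z q ≠ x q := by
        by_contra! h
        exact hz (hcode.eq_writeParities h)
      exact Or.inl ⟨q, by simp [hadamardOn, hq, one_apply_ne hzq.symm]⟩
    · exact Or.inr (if_neg hcode)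

variable (K) in
/-- After the ancillas have been measured, an ancilla is flipped if its outcome is one, and the sign
of another qubit `q` is flipped if an odd number of outcomes in this set is one. -/
def signControl (q : Q) : Finset Q :=
  if q ∈ K.anc then {q} else Finset.univ.filter fun a => q ∈ K.supp a

theorem signControl_of_mem_anc {q : Q} (hq : q ∈ K.anc) : K.signControl q = {q} := if_pos hq

theorem signControl_of_mem_chk {q : Q} (hq : q ∈ K.chk) : K.signControl q = ∅ := by
  rw [signControl, if_neg fun h => K.notMem_chk_of_mem_anc q h hq]
  exact Finset.filter_eq_empty_iff.2 fun a _ h => K.notMem_chk_of_mem_supp a q h hq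

theorem pauliOn_signControl_mulVec (t : Q → Bool) (ψ : QState Q) (x : Q → Bool) :
    (tensorMatrix (fun q =>
      if parity (K.signControl q) t then (pauliOn (K.anc ∪ K.chk) q).1 else 1) *ᵥ ψ) x =
      (∏ q, bsign (t q && parity (K.supp q) x)) *
        ψ fun q => if q ∈ K.anc then xor (x q) (t q) else x q := by
  rw [pauliOn_mulVec, prod_bsign_and_parity]
  congr 1
  · refine Finset.prod_congr rfl fun q _ => ?_
    have supp_eq_empty (hq : q ∈ K.anc ∪ K.chk) :
        (Finset.univ.filter fun a => q ∈ K.supp a) = ∅ :=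
      Finset.filter_eq_empty_iff.2 fun a _ h => (Finset.mem_union.1 hq).elim
        (K.notMem_anc_of_mem_supp a q h) (K.notMem_chk_of_mem_supp a q h)
    split_ifs with hq
    · rw [supp_eq_empty hq, parity_empty, Bool.and_false, bsign_false]
    · rw [signControl, if_neg fun h => hq (Finset.mem_union_left _ h)]
  · congr 1
    funext q
    by_cases ha : q ∈ K.anc
    · rw [if_pos (Finset.mem_union_left _ ha), if_pos ha, signControl_of_mem_anc ha,
        parity_singleton]
    · rw [if_neg ha]
      split_ifs with hq
      · rw [signControl_of_mem_chk ((Finset.mem_union.1 hq).resolve_left ha), parity_empty,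
          Bool.xor_false]
      · rfl

theorem pauliOn_projectOn_encode {ψ : QState Q} (hanc : IsBlankOn K.anc ψ)
    (hchk : IsBlankOn K.chk ψ) (t : Q → Bool) :
    tensorMatrix (fun q => if parity (K.signControl q) t then (pauliOn (K.anc ∪ K.chk) q).1 else 1)
        *ᵥ projectOn K.anc t (tensorMatrix (fun q => (hadamardOn K.anc q).1) *ᵥ K.encode ψ) =
      (((Real.sqrt 2)⁻¹ : ℝ) : ℂ) ^ K.anc.card • ψ := by
  funext x
  rw [pauliOn_signControl_mulVec, projectOn, hadamardOn_encode hchk, Pi.smul_apply, smul_eq_mul]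
  set x' : Q → Bool := fun q => if q ∈ K.anc then xor (x q) (t q) else x q
  have x'_of_mem {q} (hq : q ∈ K.anc) : x' q = xor (x q) (t q) := if_pos hq
  have x'_of_notMem {q} (hq : q ∉ K.anc) : x' q = x q := if_neg hq
  have agree_iff : (∀ q ∈ K.anc, (if q ∈ K.anc then xor (x q) (t q) else x q) = t q) ↔
      ∀ q ∈ K.anc, x q = false :=
    forall₂_congr fun q hq => by
      rw [if_pos hq]
      cases x q <;> simp
  simp only [agree_iff]
  split_ifs with hx
  · have clear_eq : clear K.anc x' = x := by
      rw [clear_congr fun q hq => x'_of_notMem hq, clear_eq_self hx]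
    have sign_eq (q) :
        bsign (x' q && parity (K.supp q) x') = bsign (t q && parity (K.supp q) x) := by
      by_cases hq : q ∈ K.anc
      · rw [parity_supp_congr (fun q hq _ => x'_of_notMem hq), x'_of_mem hq, hx q hq,
          Bool.false_xor]
      · simp only [K.supp_eq_empty q hq, parity_empty, Bool.and_false]
    have sign_mul_self : (∏ q, bsign (t q && parity (K.supp q) x)) *
        (∏ q, bsign (t q && parity (K.supp q) x)) = 1 := by
      rw [← Finset.prod_mul_distrib]
      exact Finset.prod_eq_one fun q _ => bsign_mul_self _
    rw [Finset.prod_congr rfl fun q _ => sign_eq q, clear_eq]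
    linear_combination (((Real.sqrt 2)⁻¹ : ℝ) : ℂ) ^ K.anc.card * ψ x * sign_mul_self
  · push Not at hx
    obtain ⟨q, hq, hxq⟩ := hx
    rw [hanc x q hq (by simpa using hxq), mul_zero, mul_zero]

end ParityCode

section PhaseCircuit

variable {G : SimpleGraph Q} {D D₁ D₂ b : ℕ}

theorem ComputableInDepth.prod_phase {L : (Q → Bool) → Q → Bool} (hLL : ∀ x, L (L x) = x)
    (hL : ComputableInDepth G D fun _ ψ => ψ ∘ L) (ω : Q → ℝ) :
    ComputableInDepth G (2 * D + 1) fun _ ψ x => (∏ q, phase (ω q) (L x q)) * ψ x := by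
  have conj := ((hL.comp (unconditional fun q => phaseGate (ω q))).comp hL).mono
    (D' := 2 * D + 1) (by omega)
  refine cast (congrArg (ComputableInDepth G _) ?_) conj
  funext _ ψ x
  simp only [phaseGate, tensorMatrix_diagonal, mulVec_diagonal, Function.comp_apply, hLL]

/-- One round each: encode, apply the phases, and decode. -/
theorem ParityEncoder.exists_phase_circuit (K : ParityEncoder Q) (hQ : Fintype.card Q ≤ 2 ^ b)
    (hK : ComputableInDepth G D₁ fun _ ψ => ψ ∘ K) {L : (Q → Bool) → Q → Bool}
    (hLL : ∀ x, L (L x) = x) (hL : ComputableInDepth G D₂ fun _ ψ => ψ ∘ L)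
    (hD₁ : 1 + D₁ ≤ D) (hD₂ : 3 + 2 * D₂ ≤ D) (ω : Q → ℝ) (Φ : (Q → Bool) → ℂ)
    (hΦ : ∀ x, K.IsCodeword x → ∏ q, phase (ω q) (L x q) = Φ (clear K.anc x)) :
    ∃ A : HybridCircuit G, HybridCircuit.Bounded 3 D b A ∧
      ∀ ψ, IsBlankOn K.anc ψ → IsBlankOn K.chk ψ →
        ∀ r, ∀ φ ∈ HybridCircuit.branches A r ψ, ∃ c : ℂ, φ = c • fun x => Φ x * ψ x := by
  obtain ⟨R₁, hR₁, branches_R₁⟩ := exists_parity_round hQ (fun _ => ∅)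
    (((ComputableInDepth.unconditional (hadamardOn K.anc)).comp hK).mono hD₁) K.chk
  obtain ⟨R₂, hR₂, branches_R₂⟩ := exists_parity_round hQ K.flipControl
    ((((ComputableInDepth.conditional (pauliOn (K.anc ∪ K.chk))).comp
      (hL.prod_phase hLL ω)).comp (ComputableInDepth.unconditional (hadamardOn K.anc))).mono
        (show 1 + (2 * D₂ + 1) + 1 ≤ D by omega)) K.anc
  obtain ⟨R₃, hR₃, branches_R₃⟩ := exists_parity_round hQ K.signControl
    ((ComputableInDepth.conditional (pauliOn (K.anc ∪ K.chk))).mono (show 1 ≤ D by omega)) ∅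
  refine ⟨[R₁] ++ [R₂] ++ [R₃], (hR₁.append hR₂).append hR₃, fun ψ hanc hchk r φ hφ => ?_⟩
  obtain ⟨r₁, hφ⟩ := branches_R₁ _ _ _ _ hφ
  obtain ⟨r₂, hφ⟩ := branches_R₂ _ _ _ _ hφ
  obtain ⟨r₃, hφ⟩ := branches_R₃ _ _ _ _ hφ
  set κ : ℂ := (((Real.sqrt 2)⁻¹ : ℝ) : ℂ) ^ K.anc.card
  let s q := r₁ (0, q)
  let t q := r₂ (0, q)
  have encoded := K.pauliOn_projectOn_hadamardOn hanc hchk s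
  have phased : (fun x => (∏ q, phase (ω q) (L x q)) * (κ • K.encode ψ) x) =
      K.encode fun x => (κ * Φ x) * ψ x := by
    rw [← K.mul_encode (Ψ := fun x => κ * ∏ q, phase (ω q) (L x q))
      fun x hx => congrArg (κ * ·) (hΦ x hx)]
    funext x
    rw [Pi.smul_apply, smul_eq_mul]
    ring
  have decoded := ParityCode.pauliOn_projectOn_encode (K := K.toParityCode)
    (hanc.mul fun x => κ * Φ x) (hchk.mul fun x => κ * Φ x) t
  refine ⟨κ * κ, ?_⟩
  simp only [HybridCircuit.branches, Set.mem_singleton_iff] at hφ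
  rw [encoded, phased, decoded] at hφ
  rw [hφ]
  funext x
  simp only [projectOn, Finset.notMem_empty, false_imp_iff, implies_true, if_true, Pi.smul_apply,
    smul_eq_mul]
  ring

end PhaseCircuit

end Correction

/-! ### Operations on a register -/

section Register

open Matrix

variable {Q ι : Type}

open Classical in
/-- The state of all qubits that is `φ` on the qubits `X i` and `|0⟩` on all the others. -/
noncomputable def registerState (X : ι → Q) (φ : QState ι) : QState Q :=
  fun x => if ∀ q, q ∉ Set.range X → x q = false then φ (x ∘ X) else 0

variable {X : ι → Q}

theorem registerState_smul (c : ℂ) (φ : QState ι) :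
    registerState X (c • φ) = c • registerState X φ := by
  funext x
  simp only [registerState, Pi.smul_apply, smul_eq_mul, mul_ite, mul_zero]

theorem isBlankOn_registerState {M : Finset Q} (hM : ∀ i, X i ∉ M) (φ : QState ι) :
    IsBlankOn M (registerState X φ) := by
  intro x q hq hx
  refine if_neg fun h => ?_
  rw [h q fun ⟨i, hi⟩ => hM i (hi ▸ hq)] at hx
  exact Bool.false_ne_true hx

variable [DecidableEq Q] [Fintype ι] [DecidableEq ι] {G : SimpleGraph Q} {D b : ℕ}

/-- A circuit with at most `d` rounds applies the operator `M` to the register `X`, up to a scalar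
factor that depends on the branch. The parameters `D` and `b` bound the size of the circuit as in
`HybridCircuit.Bounded`. -/
def Realizes (G : SimpleGraph Q) (X : ι → Q) (D b d : ℕ)
    (M : Matrix (ι → Bool) (ι → Bool) ℂ) : Prop :=
  ∃ A : HybridCircuit G, HybridCircuit.Bounded d D b A ∧
    ∀ φ r, ∀ χ ∈ HybridCircuit.branches A r (registerState X φ),
      ∃ c : ℂ, χ = c • registerState X (M *ᵥ φ)

theorem Realizes.mul {d d' : ℕ} {M M' : Matrix (ι → Bool) (ι → Bool) ℂ}
    (h' : Realizes G X D b d' M') (h : Realizes G X D b d M) :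
    Realizes G X D b (d + d') (M' * M) := by
  obtain ⟨A, hA, branches_A⟩ := h
  obtain ⟨A', hA', branches_A'⟩ := h'
  refine ⟨A ++ A', hA.append hA', fun φ r χ hχ => ?_⟩
  obtain ⟨r', ξ, hξ, hχ⟩ := HybridCircuit.exists_mem_branches_of_append A A' r _ χ hχ
  obtain ⟨c, rfl⟩ := branches_A φ r ξ hξ
  rw [← registerState_smul] at hχ
  obtain ⟨c', rfl⟩ := branches_A' _ _ _ hχ
  exact ⟨c' * c, by rw [mulVec_smul, registerState_smul, smul_smul, mulVec_mulVec]⟩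

variable [Fintype Q]

theorem tensorMatrix_mulVec_registerState (hX : Function.Injective X) (W : Q → Matrix Bool Bool ℂ)
    (hW : ∀ q, q ∉ Set.range X → W q = 1) (φ : QState ι) :
    tensorMatrix W *ᵥ registerState X φ = registerState X (tensorMatrix (W ∘ X) *ᵥ φ) := by
  funext x
  rw [tensorMatrix_mulVec_of_injective hX W hW]
  have blank_iff (y) : (∀ q, q ∉ Set.range X → Function.extend X y x q = false) ↔
      ∀ q, q ∉ Set.range X → x q = false :=
    forall₂_congr fun q hq => by rw [Function.extend_apply' _ _ _ hq]
  simp only [registerState, blank_iff, Function.extend_comp hX]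
  split_ifs
  · rfl
  · simp only [mul_zero, Finset.sum_const_zero]

theorem realizes_tensorMatrix (hX : Function.Injective X) (hQ : Fintype.card Q ≤ 2 ^ b)
    (hD : 1 ≤ D) (U : ι → Matrix.unitaryGroup Bool ℂ) :
    Realizes G X D b 1 (tensorMatrix fun i => (U i).1) := by
  classical
  let W : Q → Matrix.unitaryGroup Bool ℂ := Function.extend X U fun _ => 1
  have W_register : (fun q => (W q).1) ∘ X = fun i => (U i).1 :=
    funext fun i => congrArg Subtype.val (hX.extend_apply U _ i)
  have W_of_notMem (q) (hq : q ∉ Set.range X) : (W q).1 = 1 :=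
    congrArg Subtype.val (Function.extend_apply' U _ q hq)
  obtain ⟨R, hR, branches_R⟩ := exists_parity_round (G := G) hQ (fun _ => ∅)
    ((ComputableInDepth.unconditional W).mono hD) ∅
  refine ⟨[R], hR, fun φ r χ hχ => ⟨1, ?_⟩⟩
  obtain ⟨_, hχ⟩ := branches_R _ _ _ _ hχ
  rw [HybridCircuit.branches, Set.mem_singleton_iff,
    tensorMatrix_mulVec_registerState hX _ W_of_notMem, W_register] at hχ
  rw [hχ, one_smul]
  funext x
  simp only [projectOn, Finset.notMem_empty, false_imp_iff, implies_true, if_true]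

theorem ParityEncoder.realizes_diagonal (K : ParityEncoder Q) {D₁ D₂ : ℕ}
    (hQ : Fintype.card Q ≤ 2 ^ b) (hK : ComputableInDepth G D₁ fun _ ψ => ψ ∘ K)
    {L : (Q → Bool) → Q → Bool} (hLL : ∀ x, L (L x) = x)
    (hL : ComputableInDepth G D₂ fun _ ψ => ψ ∘ L) (hD₁ : 1 + D₁ ≤ D) (hD₂ : 3 + 2 * D₂ ≤ D)
    (hanc : ∀ i, X i ∉ K.anc) (hchk : ∀ i, X i ∉ K.chk) (ω : Q → ℝ) (Φ : (ι → Bool) → ℂ)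
    (hΦ : ∀ x, K.IsCodeword x → ∏ q, phase (ω q) (L x q) = Φ (x ∘ X)) :
    Realizes G X D b 3 (diagonal Φ) := by
  have clear_register (x) : clear K.anc x ∘ X = x ∘ X :=
    funext fun i => clear_of_notMem (hanc i) x
  obtain ⟨A, hA, branches_A⟩ := K.exists_phase_circuit hQ hK hLL hL hD₁ hD₂ ω
    (fun x => Φ (x ∘ X)) fun x hx => by rw [clear_register, hΦ x hx]
  refine ⟨A, hA, fun φ r χ hχ => ?_⟩
  obtain ⟨c, rfl⟩ := branches_A _ (isBlankOn_registerState hanc φ)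
    (isBlankOn_registerState hchk φ) r χ hχ
  refine ⟨c, congrArg (c • ·) (funext fun x => ?_)⟩
  simp only [registerState, mulVec_diagonal, mul_ite, mul_zero]

end Register

/-! ### Registers with two parts -/

section TwoRegisters

open Matrix

variable {ι κ : Type}

/-- The product of a state of the register `ι` and a state of the register `κ`. -/
def prodState (f : QState ι) (g : QState κ) : QState (ι ⊕ κ) :=
  fun z => f (z ∘ Sum.inl) * g (z ∘ Sum.inr)

variable [Fintype ι]

/-- A bit string on the register `κ`, paired with one on the register `ι`. -/
def splitEquiv (ι κ : Type) : (ι ⊕ κ → Bool) ≃ (κ → Bool) × (ι → Bool) :=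
  (Equiv.sumArrowEquivProdArrow ι κ Bool).trans (Equiv.prodComm _ _)

/-- The operator that applies `T x` to the register `κ` if the register `ι` is in the basis state
`|x⟩`. -/
def controlled (T : (ι → Bool) → Matrix (κ → Bool) (κ → Bool) ℂ) :
    Matrix (ι ⊕ κ → Bool) (ι ⊕ κ → Bool) ℂ :=
  (blockDiagonal T).submatrix (splitEquiv ι κ) (splitEquiv ι κ)

theorem controlled_apply (T : (ι → Bool) → Matrix (κ → Bool) (κ → Bool) ℂ)
    (z z' : ι ⊕ κ → Bool) :
    controlled T z z' =
      if z ∘ Sum.inl = z' ∘ Sum.inl then T (z ∘ Sum.inl) (z ∘ Sum.inr) (z' ∘ Sum.inr) else 0 :=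
  rfl

variable [Fintype κ]

theorem tensorMatrix_sumElim (U : ι → Matrix Bool Bool ℂ) (W : κ → Matrix Bool Bool ℂ)
    (z z' : ι ⊕ κ → Bool) :
    tensorMatrix (Sum.elim U W) z z' =
      tensorMatrix U (z ∘ Sum.inl) (z' ∘ Sum.inl) * tensorMatrix W (z ∘ Sum.inr) (z' ∘ Sum.inr) :=
  Fintype.prod_sum_type _

theorem controlled_tensorMatrix (W : κ → Matrix Bool Bool ℂ) :
    controlled (fun _ : ι → Bool => tensorMatrix W) = tensorMatrix (Sum.elim (fun _ => 1) W) := by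
  classical
  ext z z'
  rw [controlled_apply, tensorMatrix_sumElim, tensorMatrix_one, one_apply, ite_mul, one_mul,
    zero_mul]

theorem controlled_diagonal (d : (ι → Bool) → (κ → Bool) → ℂ) :
    controlled (fun x => diagonal (d x)) =
      diagonal fun z : ι ⊕ κ → Bool => d (z ∘ Sum.inl) (z ∘ Sum.inr) := by
  rw [controlled, blockDiagonal_diagonal, submatrix_diagonal_equiv]
  rfl

variable [DecidableEq ι] [DecidableEq κ]

theorem controlled_mul (T T' : (ι → Bool) → Matrix (κ → Bool) (κ → Bool) ℂ) :
    controlled T * controlled T' = controlled fun x => T x * T' x := by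
  rw [controlled, controlled, controlled, submatrix_mul_equiv, blockDiagonal_mul]

theorem sum_eq_sum_sumElim (F : (ι ⊕ κ → Bool) → ℂ) :
    ∑ z, F z = ∑ x, ∑ y, F (Sum.elim x y) := by
  rw [← (Equiv.sumArrowEquivProdArrow ι κ Bool).symm.sum_comp, Fintype.sum_prod_type]
  rfl

theorem controlled_mulVec_prodState {T : (ι → Bool) → Matrix (κ → Bool) (κ → Bool) ℂ}
    {c : (ι → Bool) → ℂ} {g : QState κ} (hg : ∀ x, T x *ᵥ g = c x • g) (f : QState ι) :
    controlled T *ᵥ prodState f g = prodState (fun x => c x * f x) g := by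
  funext z
  have value := congrFun (hg (z ∘ Sum.inl)) (z ∘ Sum.inr)
  simp only [mulVec, dotProduct, Pi.smul_apply, smul_eq_mul] at value
  simp only [mulVec, dotProduct, sum_eq_sum_sumElim, controlled_apply, prodState,
    Sum.elim_comp_inl, Sum.elim_comp_inr, ite_mul, zero_mul]
  rw [Finset.sum_comm]
  simp only [Finset.sum_ite_eq, Finset.mem_univ, if_true, mul_left_comm _ (f _), ← Finset.mul_sum,
    value]
  ring

theorem tensorMatrix_mulVec_prodState (U : ι → Matrix Bool Bool ℂ) (f : QState ι) (g : QState κ) :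
    tensorMatrix (Sum.elim U fun _ => 1) *ᵥ prodState f g = prodState (tensorMatrix U *ᵥ f) g := by
  funext z
  simp only [mulVec, dotProduct, sum_eq_sum_sumElim, tensorMatrix_sumElim, prodState,
    Sum.elim_comp_inl, Sum.elim_comp_inr, Finset.sum_mul]
  refine Finset.sum_congr rfl fun x _ => ?_
  have diagonal_entry : tensorMatrix (fun _ : κ => 1) (z ∘ Sum.inr) (z ∘ Sum.inr) = 1 := by
    rw [tensorMatrix_one, one_apply_eq]
  have off_diagonal (y) (hy : y ≠ z ∘ Sum.inr) :
      tensorMatrix (fun _ : κ => 1) (z ∘ Sum.inr) y = 0 := by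
    rw [tensorMatrix_one, one_apply_ne hy.symm]
  rw [Fintype.sum_eq_single (z ∘ Sum.inr) fun y hy => by rw [off_diagonal y hy]; ring,
    diagonal_entry]
  ring

end TwoRegisters

/-! ### The parity encoder of the grid -/

theorem cnotMap_setOf_apply {Q ι : Type} {a b : ι → Q} (hb : Function.Injective b) (r : ι → Bool)
    (x : Q → Bool) (i : ι) :
    cnotMap a b {p | r p = true} x (b i) = xor (x (b i)) (r i && x (a i)) := by
  cases hr : r i
  · rw [cnotMap_apply_of_forall_ne x fun j hj h => by simp [← hb h, hj.out] at hr]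
    simp
  · rw [cnotMap_apply_target hb.injOn x (i := i) hr]
    simp

namespace Grid

variable {n m : ℕ}

/-- The qubit at position `s` of the `j`-th cell in row `i`. The positions 1, 2, 3, 4 belong to the
cell, whereas `site i j 0` is the last qubit of the cell before it. -/
def site (i : Fin n) (j : Fin m) (s : Fin 5) : Fin n × Fin (4 * m + 1) :=
  (i, ⟨4 * j + s, by omega⟩)

theorem site_eq_iff {i i' : Fin n} {j j' : Fin m} {s s' : Fin 5} :
    site i j s = site i' j' s' ↔ i.1 = i'.1 ∧ 4 * j.1 + s.1 = 4 * j'.1 + s'.1 := by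
  simp [site, Prod.ext_iff, Fin.ext_iff]

theorem site_injective (s : Fin 5) :
    Function.Injective fun p : Fin n × Fin m => site p.1 p.2 s := by
  intro p p' h
  simp only [site_eq_iff] at h
  exact Prod.ext (Fin.ext h.1) (Fin.ext (by omega))

theorem site_ne_site {s t : Fin 5} (h : (s.1 + 4 - t.1) % 4 ≠ 0) (i i' : Fin n) (j j' : Fin m) :
    site i j s ≠ site i' j' t := by
  rw [Ne, site_eq_iff]
  omega

theorem site_succ_zero (i : Fin n) {k : ℕ} (hk : k + 1 < m) :
    site i ⟨k + 1, hk⟩ 0 = site i ⟨k, by omega⟩ 4 :=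
  site_eq_iff.2 ⟨rfl, by simp; omega⟩

/-- The row before row `i`. The first row is its own predecessor. -/
def prevRow (i : Fin n) : Fin n := ⟨i - 1, by omega⟩

theorem adj_site_succ (i : Fin n) (j : Fin m) {s s' : Fin 5} (h : s.1 + 1 = s'.1) :
    (gridGraph n (4 * m + 1)).Adj (site i j s) (site i j s') := by
  rw [SimpleGraph.boxProd_adj, SimpleGraph.pathGraph_adj, SimpleGraph.pathGraph_adj]
  exact Or.inr ⟨Or.inl (by simp only [site]; omega), rfl⟩

theorem adj_prevRow {i : Fin n} (hi : i.1 ≠ 0) (j : Fin m) (s : Fin 5) :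
    (gridGraph n (4 * m + 1)).Adj (site (prevRow i) j s) (site i j s) := by
  rw [SimpleGraph.boxProd_adj, SimpleGraph.pathGraph_adj]
  exact Or.inl ⟨Or.inl (by simp only [site, prevRow]; omega), rfl⟩

/-- CNOT gates from position `s` to position `t` in the cells selected by `r`. -/
noncomputable def rowAdd (s t : Fin 5) (r : Fin n × Fin m → Bool) :=
  cnotMap (fun p : Fin n × Fin m => site p.1 p.2 s) (fun p => site p.1 p.2 t) {p | r p = true}

/-- CNOT gates from position 2 in the row before to position 1, in the cells selected by `r`. -/
noncomputable def colAdd (r : Fin n × Fin m → Bool) :=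
  cnotMap (fun p : Fin n × Fin m => site (prevRow p.1) p.2 2) (fun p => site p.1 p.2 1)
    {p | r p = true}

section Depth

open ComputableInDepth

theorem computableInDepth_rowAdd {s t : Fin 5} (h : s.1 + 1 = t.1 ∨ t.1 + 1 = s.1)
    (r : Fin n × Fin m → Bool) :
    ComputableInDepth (gridGraph n (4 * m + 1)) 1 fun _ ψ => ψ ∘ rowAdd s t r := by
  refine cnot (fun p _ => ?_) (site_injective s).injOn (site_injective t).injOn
    fun p _ p' _ => site_ne_site (by omega) _ _ _ _
  rcases h with h | h
  · exact adj_site_succ _ _ h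
  · exact (adj_site_succ _ _ h).symm

theorem computableInDepth_rowAdd_trans {s u t : Fin 5} {D D' : ℕ} {r : Fin n × Fin m → Bool}
    (h : ComputableInDepth (gridGraph n (4 * m + 1)) D fun _ ψ => ψ ∘ rowAdd s u r)
    (h' : ComputableInDepth (gridGraph n (4 * m + 1)) D' fun _ ψ => ψ ∘ rowAdd u t r)
    (hsu : (s.1 + 4 - u.1) % 4 ≠ 0) (hst : (s.1 + 4 - t.1) % 4 ≠ 0)
    (hut : (u.1 + 4 - t.1) % 4 ≠ 0) :
    ComputableInDepth (gridGraph n (4 * m + 1)) (2 * D + 2 * D') fun _ ψ => ψ ∘ rowAdd s t r :=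
  cnot_trans h h' (site_injective u).injOn (site_injective t).injOn
    (fun _ _ _ _ => site_ne_site hsu _ _ _ _) (fun _ _ _ _ => site_ne_site hst _ _ _ _)
    fun _ _ _ _ => site_ne_site hut _ _ _ _

theorem computableInDepth_rowAdd_zero_three (r : Fin n × Fin m → Bool) :
    ComputableInDepth (gridGraph n (4 * m + 1)) 10 fun _ ψ => ψ ∘ rowAdd 0 3 r :=
  computableInDepth_rowAdd_trans (computableInDepth_rowAdd (t := 1) (by decide) r)
    (computableInDepth_rowAdd_trans (computableInDepth_rowAdd (t := 2) (by decide) r)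
      (computableInDepth_rowAdd (by decide) r) (by decide) (by decide) (by decide))
    (by decide) (by decide) (by decide)

-- Rows of the same parity are not adjacent, so that their gates can be applied in parallel.
theorem computableInDepth_colAdd (b : ℕ) :
    ComputableInDepth (gridGraph n (4 * m + 1)) 4 fun _ ψ =>
      ψ ∘ colAdd fun p => decide (p.1.1 ≠ 0 ∧ p.1.1 % 2 = b) := by
  have prevRow_injOn : Set.InjOn (fun p : Fin n × Fin m => site (prevRow p.1) p.2 2)
      {p | decide (p.1.1 ≠ 0 ∧ p.1.1 % 2 = b) = true} := by
    intro p hp p' hp' h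
    simp only [Set.mem_ofPred_eq, decide_eq_true_eq] at hp hp'
    simp only [site_eq_iff, prevRow] at h
    exact Prod.ext (Fin.ext (by omega)) (Fin.ext (by omega))
  have prevRow_ne (p) (hp : p ∈ {p : Fin n × Fin m | decide (p.1.1 ≠ 0 ∧ p.1.1 % 2 = b) = true})
      (p') (hp' : p' ∈ {p : Fin n × Fin m | decide (p.1.1 ≠ 0 ∧ p.1.1 % 2 = b) = true}) :
      site (prevRow p.1) p.2 2 ≠ site p'.1 p'.2 2 := by
    simp only [Set.mem_ofPred_eq, decide_eq_true_eq] at hp hp'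
    simp only [ne_eq, site_eq_iff, prevRow]
    omega
  have vertical := cnot (G := gridGraph n (4 * m + 1))
    (fun p hp => adj_prevRow (of_decide_eq_true hp).1 p.2 2) prevRow_injOn (site_injective 2).injOn
    prevRow_ne
  exact cnot_trans vertical (computableInDepth_rowAdd (s := 2) (t := 1) (by decide) _)
    (site_injective 2).injOn (site_injective 1).injOn prevRow_ne
    (fun _ _ _ _ => site_ne_site (by decide) _ _ _ _)
    fun _ _ _ _ => site_ne_site (by decide) _ _ _ _

end Depth

section Apply

variable (x : Fin n × Fin (4 * m + 1) → Bool) {q : Fin n × Fin (4 * m + 1)}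

theorem rowAdd_apply (s t : Fin 5) (r : Fin n × Fin m → Bool) (i : Fin n) (j : Fin m) :
    rowAdd s t r x (site i j t) = xor (x (site i j t)) (r (i, j) && x (site i j s)) :=
  cnotMap_setOf_apply (site_injective t) r x (i, j)

theorem colAdd_apply (r : Fin n × Fin m → Bool) (i : Fin n) (j : Fin m) :
    colAdd r x (site i j 1) = xor (x (site i j 1)) (r (i, j) && x (site (prevRow i) j 2)) :=
  cnotMap_setOf_apply (site_injective 1) r x (i, j)

variable {x}

theorem rowAdd_apply_of_ne {s t : Fin 5} {r : Fin n × Fin m → Bool}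
    (h : ∀ i j, r (i, j) = true → site i j t ≠ q) : rowAdd s t r x q = x q :=
  cnotMap_apply_of_forall_ne x fun p hp => h p.1 p.2 hp

theorem colAdd_apply_of_ne {r : Fin n × Fin m → Bool}
    (h : ∀ i j, r (i, j) = true → site i j 1 ≠ q) : colAdd r x q = x q :=
  cnotMap_apply_of_forall_ne x fun p hp => h p.1 p.2 hp

theorem rowAdd_apply_site {s t u : Fin 5} (h : (t.1 + 4 - u.1) % 4 ≠ 0)
    {r : Fin n × Fin m → Bool} (i : Fin n) (j : Fin m) :
    rowAdd s t r x (site i j u) = x (site i j u) :=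
  rowAdd_apply_of_ne fun _ _ _ => site_ne_site h _ _ _ _

theorem colAdd_apply_site {u : Fin 5} (h : (5 - u.1) % 4 ≠ 0) {r : Fin n × Fin m → Bool}
    (i : Fin n) (j : Fin m) : colAdd r x (site i j u) = x (site i j u) :=
  colAdd_apply_of_ne fun _ _ _ => site_ne_site h _ _ _ _

end Apply

/-- The syndrome map of the grid code. Position 1 compares position 2 with position 2 in the row
before, and position 3 compares position 4 with the parity of position 0 (if `ρ`) and position 2
(if `κ`). So position 2 carries a copy of the data in the first row through the whole column, and
position 4 carries a running parity along the row. -/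
noncomputable def encodeMap (ρ κ : Fin n × Fin m → Bool) (x : Fin n × Fin (4 * m + 1) → Bool) :
    Fin n × Fin (4 * m + 1) → Bool :=
  rowAdd 2 1 (fun p => decide (p.1.1 ≠ 0)) <|
  colAdd (fun p => decide (p.1.1 ≠ 0 ∧ p.1.1 % 2 = 0)) <|
  colAdd (fun p => decide (p.1.1 ≠ 0 ∧ p.1.1 % 2 = 1)) <|
  rowAdd 4 3 (fun _ => true) <| rowAdd 0 3 ρ <| rowAdd 2 3 κ x

section EncodeMap

variable (ρ κ : Fin n × Fin m → Bool)

theorem computableInDepth_encodeMap :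
    ComputableInDepth (gridGraph n (4 * m + 1)) 21 fun _ ψ => ψ ∘ encodeMap ρ κ :=
  (computableInDepth_rowAdd (by decide) _).comp (computableInDepth_colAdd 0)
    |>.comp (computableInDepth_colAdd 1)
    |>.comp (computableInDepth_rowAdd (by decide) _)
    |>.comp (computableInDepth_rowAdd_zero_three ρ)
    |>.comp (computableInDepth_rowAdd (by decide) κ)

variable (x : Fin n × Fin (4 * m + 1) → Bool)

theorem encodeMap_apply_three (i : Fin n) (j : Fin m) :
    encodeMap ρ κ x (site i j 3) = xor (xor (xor (x (site i j 3)) (κ (i, j) && x (site i j 2)))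
      (ρ (i, j) && x (site i j 0))) (x (site i j 4)) := by
  rw [encodeMap, rowAdd_apply_site (by decide), colAdd_apply_site (by decide),
    colAdd_apply_site (by decide), rowAdd_apply, rowAdd_apply, rowAdd_apply,
    rowAdd_apply_site (by decide), rowAdd_apply_site (by decide), rowAdd_apply_site (by decide),
    Bool.true_and]

theorem encodeMap_apply_one {i : Fin n} (hi : i.1 ≠ 0) (j : Fin m) :
    encodeMap ρ κ x (site i j 1) =
      xor (xor (x (site i j 1)) (x (site (prevRow i) j 2))) (x (site i j 2)) := by
  have colAdd_two {r} {x} (i : Fin n) (j : Fin m) : colAdd r x (site i j 2) = x (site i j 2) :=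
    colAdd_apply_site (by decide) i j
  have rowAdd_three_one {s r x} (i : Fin n) (j : Fin m) :
      rowAdd s 3 r x (site i j 1) = x (site i j 1) := rowAdd_apply_site (by decide) i j
  have rowAdd_three_two {s r x} (i : Fin n) (j : Fin m) :
      rowAdd s 3 r x (site i j 2) = x (site i j 2) := rowAdd_apply_site (by decide) i j
  simp only [encodeMap, rowAdd_apply, colAdd_apply, colAdd_two, rowAdd_three_one, rowAdd_three_two]
  rcases Nat.mod_two_eq_zero_or_one i.1 with h | h <;> simp [hi, h]

theorem encodeMap_apply_of_ne {q : Fin n × Fin (4 * m + 1)}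
    (h₁ : ∀ (i : Fin n) (j : Fin m), i.1 ≠ 0 → site i j 1 ≠ q)
    (h₃ : ∀ (i : Fin n) (j : Fin m), site i j 3 ≠ q) : encodeMap ρ κ x q = x q := by
  rw [encodeMap, rowAdd_apply_of_ne fun i j h => h₁ i j (of_decide_eq_true h),
    colAdd_apply_of_ne fun i j h => h₁ i j (of_decide_eq_true h).1,
    colAdd_apply_of_ne fun i j h => h₁ i j (of_decide_eq_true h).1,
    rowAdd_apply_of_ne fun i j _ => h₃ i j, rowAdd_apply_of_ne fun i j _ => h₃ i j,
    rowAdd_apply_of_ne fun i j _ => h₃ i j]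

theorem encodeMap_apply_site (i : Fin n) (j : Fin m) {s : Fin 5} (hs : s.1 % 2 = 0) :
    encodeMap ρ κ x (site i j s) = x (site i j s) := by
  refine encodeMap_apply_of_ne ρ κ x (fun _ _ _ => site_ne_site ?_ _ _ _ _)
    fun _ _ => site_ne_site ?_ _ _ _ _ <;> norm_num <;> omega

theorem encodeMap_encodeMap : encodeMap ρ κ (encodeMap ρ κ x) = x := by
  have even_site {s : Fin 5} (hs : s.1 % 2 = 0) (i : Fin n) (j : Fin m) :
      encodeMap ρ κ x (site i j s) = x (site i j s) := encodeMap_apply_site ρ κ x i j hs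
  funext q
  by_cases h₃ : ∃ (i : Fin n) (j : Fin m), site i j 3 = q
  · obtain ⟨i, j, rfl⟩ := h₃
    rw [encodeMap_apply_three, encodeMap_apply_three, even_site rfl, even_site rfl, even_site rfl]
    cases x (site i j 3) <;> cases (κ (i, j) && x (site i j 2)) <;>
      cases (ρ (i, j) && x (site i j 0)) <;> cases x (site i j 4) <;> rfl
  by_cases h₁ : ∃ (i : Fin n) (j : Fin m), i.1 ≠ 0 ∧ site i j 1 = q
  · obtain ⟨i, j, hi, rfl⟩ := h₁
    rw [encodeMap_apply_one _ _ _ hi, encodeMap_apply_one _ _ _ hi, even_site rfl, even_site rfl]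
    cases x (site i j 1) <;> cases x (site (prevRow i) j 2) <;> cases x (site i j 2) <;> rfl
  · push Not at h₁ h₃
    rw [encodeMap_apply_of_ne _ _ _ h₁ h₃, encodeMap_apply_of_ne _ _ _ h₁ h₃]

end EncodeMap

/-- The ancillas of the grid code: position 4 of every cell, and position 2 outside the first
row. -/
def anc (n m : ℕ) : Finset (Fin n × Fin (4 * m + 1)) :=
  {q | q.2.1 % 4 = 0 ∧ q.2.1 ≠ 0 ∨ q.2.1 % 4 = 2 ∧ q.1.1 ≠ 0}

/-- The check qubits of the grid code: position 3 of every cell, and position 1 outside the first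
row. -/
def chk (n m : ℕ) : Finset (Fin n × Fin (4 * m + 1)) :=
  {q | q.2.1 % 4 = 3 ∨ q.2.1 % 4 = 1 ∧ q.1.1 ≠ 0}

theorem mem_anc {q : Fin n × Fin (4 * m + 1)} :
    q ∈ anc n m ↔ q.2.1 % 4 = 0 ∧ q.2.1 ≠ 0 ∨ q.2.1 % 4 = 2 ∧ q.1.1 ≠ 0 :=
  Finset.mem_filter_univ q

theorem mem_chk {q : Fin n × Fin (4 * m + 1)} :
    q ∈ chk n m ↔ q.2.1 % 4 = 3 ∨ q.2.1 % 4 = 1 ∧ q.1.1 ≠ 0 :=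
  Finset.mem_filter_univ q

theorem site_three_mem_chk (i : Fin n) (j : Fin m) : site i j 3 ∈ chk n m :=
  mem_chk.2 (Or.inl (Nat.mul_add_mod _ _ _))

theorem site_one_mem_chk {i : Fin n} (hi : i.1 ≠ 0) (j : Fin m) : site i j 1 ∈ chk n m :=
  mem_chk.2 (Or.inr ⟨Nat.mul_add_mod _ _ _, hi⟩)

theorem card_chk_le : (chk n m).card ≤ (anc n m).card := by
  refine Finset.card_le_card_of_injOn (fun q => (q.1, q.2 + 1)) (fun q hq => ?_)
    fun ⟨i, k⟩ _ ⟨i', k'⟩ _ h => by simpa using h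
  have hq := mem_chk.1 hq
  have val_succ : (q.2 + 1).1 = q.2.1 + 1 := Fin.val_add_one_of_lt' (by omega)
  refine mem_anc.2 ?_
  simp only [val_succ]
  omega

theorem encodeMap_apply_of_notMem (ρ κ : Fin n × Fin m → Bool) (x : Fin n × Fin (4 * m + 1) → Bool)
    {q : Fin n × Fin (4 * m + 1)} (hq : q ∉ chk n m) : encodeMap ρ κ x q = x q :=
  encodeMap_apply_of_ne ρ κ x (fun _ j hi h => hq (h ▸ site_one_mem_chk hi j))
    fun i j h => hq (h ▸ site_three_mem_chk i j)

end Grid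

section IsRecoverable

variable {Q : Type} {F C : Finset Q} {V : (Q → Bool) → Q → Bool} {f g : (Q → Bool) → Bool}

theorem IsRecoverable.xor (hf : IsRecoverable F C V f) (hg : IsRecoverable F C V g) :
    IsRecoverable F C V fun x => Bool.xor (f x) (g x) := by
  classical
  obtain ⟨S, E, hS, hE, hf⟩ := hf
  obtain ⟨S', E', hS', hE', hg⟩ := hg
  refine ⟨symmDiff S S', symmDiff E E', fun q hq => ?_, fun q hq => ?_, fun x hx => ?_⟩
  · rcases Finset.mem_symmDiff.1 hq with h | h
    exacts [hS q h.1, hS' q h.1]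
  · rcases Finset.mem_symmDiff.1 hq with h | h
    exacts [hE h.1, hE' h.1]
  · simp only [hf x hx, hg x hx, parity_symmDiff]
    cases parity S x <;> cases parity S' x <;> cases parity E (V x) <;> cases parity E' (V x) <;>
      rfl

theorem isRecoverable_false : IsRecoverable F C V fun _ => false :=
  ⟨∅, ∅, by simp, by simp, fun x _ => by simp⟩

theorem IsRecoverable.and_left (hf : IsRecoverable F C V f) (b : Bool) :
    IsRecoverable F C V fun x => b && f x := by
  cases b
  · exact isRecoverable_false
  · simpa using hf

theorem isRecoverable_apply {q : Q} (hF : q ∉ F) (hC : q ∉ C) : IsRecoverable F C V fun x => x q :=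
  ⟨{q}, ∅, by simp [hF, hC], by simp, fun x _ => by simp⟩

theorem isRecoverable_chk {q : Q} (hC : q ∈ C) : IsRecoverable F C V fun x => V x q :=
  ⟨∅, {q}, by simp, by simpa using hC, fun x _ => by simp⟩

theorem IsRecoverable.congr (hf : IsRecoverable F C V f)
    (h : ∀ x, (∀ q ∈ C, x q = false) → g x = f x) : IsRecoverable F C V g := by
  obtain ⟨S, E, hS, hE, hf⟩ := hf
  exact ⟨S, E, hS, hE, fun x hx => (h x hx).trans (hf x hx)⟩

end IsRecoverable

namespace Grid

variable {n m : ℕ} (ρ κ : Fin n × Fin m → Bool)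

theorem isRecoverable_two (i : Fin n) (j : Fin m) :
    IsRecoverable (anc n m) (chk n m) (encodeMap ρ κ) fun x => x (site i j 2) := by
  obtain ⟨k, hk⟩ := i
  induction k with
  | zero =>
    refine isRecoverable_apply ?_ ?_
    · simp [mem_anc, site]
    · simp [mem_chk, site]
  | succ k ih =>
    have row_ne_zero : (⟨k + 1, hk⟩ : Fin n).1 ≠ 0 := Nat.succ_ne_zero k
    have check_mem := site_one_mem_chk row_ne_zero j
    refine ((ih (by omega)).xor (isRecoverable_chk check_mem)).congr fun x hx => ?_
    rw [encodeMap_apply_one _ _ _ row_ne_zero, hx _ check_mem]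
    have prevRow_eq : prevRow (⟨k + 1, hk⟩ : Fin n) = ⟨k, by omega⟩ := rfl
    simp [prevRow_eq]

theorem isRecoverable_four_of_zero {i : Fin n} {j : Fin m}
    (h : IsRecoverable (anc n m) (chk n m) (encodeMap ρ κ) fun x => x (site i j 0)) :
    IsRecoverable (anc n m) (chk n m) (encodeMap ρ κ) fun x => x (site i j 4) := by
  have check_mem := site_three_mem_chk i j
  refine (((h.and_left (ρ (i, j))).xor ((isRecoverable_two ρ κ i j).and_left (κ (i, j)))).xor
    (isRecoverable_chk check_mem)).congr fun x hx => ?_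
  rw [encodeMap_apply_three, hx _ check_mem]
  cases (ρ (i, j) && x (site i j 0)) <;> cases (κ (i, j) && x (site i j 2)) <;>
    cases x (site i j 4) <;> rfl

theorem isRecoverable_four (i : Fin n) (j : Fin m) :
    IsRecoverable (anc n m) (chk n m) (encodeMap ρ κ) fun x => x (site i j 4) := by
  obtain ⟨k, hk⟩ := j
  induction k with
  | zero =>
    refine isRecoverable_four_of_zero ρ κ (isRecoverable_apply ?_ ?_)
    · simp [mem_anc, site]
    · simp [mem_chk, site]
  | succ k ih =>
    refine isRecoverable_four_of_zero ρ κ ?_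
    rw [site_succ_zero i hk]
    exact ih _

theorem isRecoverable_of_mem_anc {a : Fin n × Fin (4 * m + 1)} (ha : a ∈ anc n m) :
    IsRecoverable (anc n m) (chk n m) (encodeMap ρ κ) fun x => x a := by
  obtain ⟨i, ⟨k, hk⟩⟩ := a
  rcases mem_anc.1 ha with ⟨hmod, hne⟩ | ⟨hmod, -⟩ <;> simp only at *
  · have a_eq : site i ⟨k / 4 - 1, by omega⟩ 4 = (i, ⟨k, hk⟩) :=
      Prod.ext rfl (Fin.ext (by simp [site]; omega))
    exact a_eq ▸ isRecoverable_four ρ κ _ _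
  · have a_eq : site i ⟨k / 4, by omega⟩ 2 = (i, ⟨k, hk⟩) :=
      Prod.ext rfl (Fin.ext (by simp [site]; omega))
    exact a_eq ▸ isRecoverable_two ρ κ _ _

theorem exists_parityEncoder :
    ∃ K : ParityEncoder (Fin n × Fin (4 * m + 1)),
      K.anc = anc n m ∧ K.chk = chk n m ∧ K.toFun = encodeMap ρ κ :=
  ParityEncoder.exists_of_isRecoverable
    (fun q hF hC => by
      have anc_site := mem_anc.1 hF
      have chk_site := mem_chk.1 hC
      omega)
    card_chk_le (encodeMap_encodeMap ρ κ) (fun x _ => encodeMap_apply_of_notMem ρ κ x)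
    fun _ => isRecoverable_of_mem_anc ρ κ

end Grid

/-! ### Diagonal operators on the grid -/

theorem parity_inter_insert {Q : Type} [DecidableEq Q] (S : Finset Q) {T : Finset Q} {q : Q}
    (hq : q ∉ T) (x : Q → Bool) :
    parity (S ∩ insert q T) x = xor (decide (q ∈ S) && x q) (parity (S ∩ T) x) := by
  by_cases hS : q ∈ S
  · rw [Finset.inter_insert_of_mem hS,
      parity_insert fun h => hq (Finset.mem_of_mem_inter_right h)]
    simp [hS]
  · rw [Finset.inter_insert_of_notMem hS]
    simp [hS]

namespace Grid

variable {n m : ℕ}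

/-- The data register: the first column. -/
def dataSite (i : Fin n) : Fin n × Fin (4 * m + 1) := (i, 0)

/-- The auxiliary register: position 2 of the cells in the first row. -/
def auxSite (hn : 0 < n) (j : Fin m) : Fin n × Fin (4 * m + 1) := site ⟨0, hn⟩ j 2

/-- The data register together with the auxiliary register. -/
def register (hn : 0 < n) : Fin n ⊕ Fin m → Fin n × Fin (4 * m + 1) :=
  Sum.elim dataSite (auxSite hn)

theorem site_zero (i : Fin n) {j : Fin m} (hj : j.1 = 0) : site i j 0 = dataSite i := by
  simp [site, dataSite, hj]

theorem register_injective (hn : 0 < n) : Function.Injective (register (m := m) hn) := by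
  refine Function.Injective.sumElim (fun i i' h => ?_) (fun j j' h => ?_) fun i j h => ?_
  · exact congrArg Prod.fst h
  · exact (Prod.ext_iff.1 (site_injective 2 h : ((⟨0, hn⟩ : Fin n), j) = (⟨0, hn⟩, j'))).2
  · simp [dataSite, auxSite, site, Prod.ext_iff, Fin.ext_iff] at h

theorem register_notMem_anc (hn : 0 < n) (i : Fin n ⊕ Fin m) : register hn i ∉ anc n m := by
  rcases i with i | j <;> simp [register, mem_anc, dataSite, auxSite, site]

theorem register_notMem_chk (hn : 0 < n) (i : Fin n ⊕ Fin m) : register hn i ∉ chk n m := by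
  rcases i with i | j <;> simp [register, mem_chk, dataSite, auxSite, site]

theorem rowAdd_rowAdd {s t : Fin 5} (h : (s.1 + 4 - t.1) % 4 ≠ 0) (r : Fin n × Fin m → Bool)
    (x : Fin n × Fin (4 * m + 1) → Bool) : rowAdd s t r (rowAdd s t r x) = x := by
  funext q
  by_cases hq : ∃ (i : Fin n) (j : Fin m), site i j t = q
  · obtain ⟨i, j, rfl⟩ := hq
    have control (i : Fin n) (j : Fin m) : rowAdd s t r x (site i j s) = x (site i j s) :=
      rowAdd_apply_of_ne fun _ _ _ => (site_ne_site h _ _ _ _).symm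
    rw [rowAdd_apply, rowAdd_apply, control, Bool.xor_assoc, Bool.xor_self, Bool.xor_false]
  · push Not at hq
    rw [rowAdd_apply_of_ne fun i j _ => hq i j, rowAdd_apply_of_ne fun i j _ => hq i j]

section Codeword

variable {ρ κ : Fin n × Fin m → Bool} {x : Fin n × Fin (4 * m + 1) → Bool}

theorem apply_site_two_eq (hx : ∀ q ∈ chk n m, x q = false)
    (hVx : ∀ q ∈ chk n m, encodeMap ρ κ x q = false) (hn : 0 < n) (i : Fin n) (j : Fin m) :
    x (site i j 2) = x (auxSite hn j) := by
  obtain ⟨k, hk⟩ := i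
  induction k with
  | zero => rfl
  | succ k ih =>
    have row_ne_zero : (⟨k + 1, hk⟩ : Fin n).1 ≠ 0 := Nat.succ_ne_zero k
    have check := hVx _ (site_one_mem_chk row_ne_zero j)
    rw [encodeMap_apply_one _ _ _ row_ne_zero, hx _ (site_one_mem_chk row_ne_zero j),
      Bool.false_xor, bne_eq_false_iff_eq] at check
    exact check.symm.trans (ih _)

theorem apply_site_four_eq (hx : ∀ q ∈ chk n m, x q = false)
    (hVx : ∀ q ∈ chk n m, encodeMap ρ κ x q = false) (i : Fin n) (j : Fin m) :
    x (site i j 4) = xor (κ (i, j) && x (site i j 2)) (ρ (i, j) && x (site i j 0)) := by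
  have check := hVx _ (site_three_mem_chk i j)
  rw [encodeMap_apply_three, hx _ (site_three_mem_chk i j), Bool.false_xor,
    bne_eq_false_iff_eq] at check
  exact check.symm

end Codeword

/-- The bits `R i j` are computed from left to right in each row: `R i j` is the sum of `g j` (if
`κ (i, j)`) and the bit before it (if `ρ (i, j)`), where the row starts with the data bit `x i`. -/
structure IsRunningParity (ρ κ : Fin n × Fin m → Bool) (x : Fin n → Bool) (g : Fin m → Bool)
    (R : Fin n → Fin m → Bool) : Prop where
  first : ∀ i (j : Fin m), j.1 = 0 → R i j = xor (κ (i, j) && g j) (ρ (i, j) && x i)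
  next : ∀ i k (hk : k + 1 < m), R i ⟨k + 1, hk⟩ =
    xor (κ (i, ⟨k + 1, hk⟩) && g ⟨k + 1, hk⟩) (ρ (i, ⟨k + 1, hk⟩) && R i ⟨k, by omega⟩)

theorem isRunningParity_site_four {ρ κ : Fin n × Fin m → Bool}
    {x : Fin n × Fin (4 * m + 1) → Bool} (hx : ∀ q ∈ chk n m, x q = false)
    (hVx : ∀ q ∈ chk n m, encodeMap ρ κ x q = false) (hn : 0 < n) :
    IsRunningParity ρ κ (x ∘ dataSite) (x ∘ auxSite hn) fun i j => x (site i j 4) where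
  first i j hj := by
    rw [apply_site_four_eq hx hVx, apply_site_two_eq hx hVx hn, site_zero i hj]
    rfl
  next i k hk := by
    rw [apply_site_four_eq hx hVx, apply_site_two_eq hx hVx hn, site_succ_zero i hk]
    rfl

theorem realizes_running_phases (hn : 0 < n) {b : ℕ} (hQ : n * (4 * m + 1) ≤ 2 ^ b)
    (ρ κ lam : Fin n × Fin m → Bool) (θ : Fin n × Fin m → ℝ)
    (P : (Fin n → Bool) → (Fin m → Bool) → ℂ)
    (hP : ∀ x g R, IsRunningParity ρ κ x g R →
      ∏ p : Fin n × Fin m, phase (θ p) (xor (R p.1 p.2) (lam p && g p.2)) = P x g) :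
    Realizes (gridGraph n (4 * m + 1)) (register hn) 30 b 3
      (controlled fun x => Matrix.diagonal (P x)) := by
  obtain ⟨K, K_anc, K_chk, K_toFun⟩ := exists_parityEncoder ρ κ
  have depth_L : ComputableInDepth (gridGraph n (4 * m + 1)) 4 fun _ ψ => ψ ∘ rowAdd 2 4 lam :=
    computableInDepth_rowAdd_trans (computableInDepth_rowAdd (t := 3) (by decide) lam)
      (computableInDepth_rowAdd (by decide) lam) (by decide) (by decide) (by decide)
  rw [controlled_diagonal]
  refine K.realizes_diagonal (by simpa using hQ) (K_toFun ▸ computableInDepth_encodeMap ρ κ)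
    (rowAdd_rowAdd (by decide) lam) depth_L (by norm_num) (by norm_num)
    (K_anc ▸ register_notMem_anc hn) (K_chk ▸ register_notMem_chk hn)
    (Function.extend (fun p : Fin n × Fin m => site p.1 p.2 4) θ 0) _ fun x hx => ?_
  have x_chk := hx.chk_eq_false
  have Kx_chk := ParityEncoder.chk_apply_eq_false_of_isCodeword hx
  rw [K_toFun] at Kx_chk
  rw [K_chk] at x_chk Kx_chk
  refine Eq.trans ?_ (hP _ _ _ (isRunningParity_site_four x_chk Kx_chk hn))
  symm
  refine Fintype.prod_of_injective _ (site_injective 4) _ _ (fun q hq => ?_) fun p => ?_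
  · rw [Function.extend_apply' _ _ _ hq]
    exact phase_zero _
  · rw [(site_injective 4).extend_apply, rowAdd_apply, apply_site_two_eq x_chk Kx_chk hn]
    rfl

theorem IsRunningParity.eq_data {x : Fin n → Bool} {g : Fin m → Bool} {R : Fin n → Fin m → Bool}
    (hR : IsRunningParity (fun _ => true) (fun _ => false) x g R) (i : Fin n) (j : Fin m) :
    R i j = x i := by
  obtain ⟨k, hk⟩ := j
  induction k with
  | zero => simp [hR.first i ⟨0, hk⟩ rfl]
  | succ k ih => simp [hR.next i k hk, ih]

theorem IsRunningParity.eq_parity {S : Fin n → Finset (Fin m)} {x : Fin n → Bool}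
    {g : Fin m → Bool} {R : Fin n → Fin m → Bool}
    (hR : IsRunningParity (fun p => decide (p.2.1 ≠ 0)) (fun p => decide (p.2 ∈ S p.1)) x g R)
    (i : Fin n) (j : Fin m) : R i j = parity (S i ∩ Finset.Iic j) g := by
  obtain ⟨k, hk⟩ := j
  induction k with
  | zero =>
    have Iic_eq : Finset.Iic (⟨0, hk⟩ : Fin m) = insert ⟨0, hk⟩ ∅ := by
      ext j
      simp [Fin.le_def, Fin.ext_iff]
    rw [hR.first _ _ rfl, Iic_eq, parity_inter_insert _ (Finset.notMem_empty _)]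
    simp
  | succ k ih =>
    have Iic_eq : Finset.Iic (⟨k + 1, hk⟩ : Fin m) =
        insert ⟨k + 1, hk⟩ (Finset.Iic ⟨k, by omega⟩) := by
      ext j
      simp only [Finset.mem_insert, Finset.mem_Iic, Fin.le_def, Fin.ext_iff]
      omega
    rw [hR.next i k hk, Iic_eq, parity_inter_insert _ (by simp [Fin.le_def]), ih]
    simp

theorem realizes_xor_phases (hn : 0 < n) {b : ℕ} (hQ : n * (4 * m + 1) ≤ 2 ^ b) (β : Fin m → ℝ) :
    Realizes (gridGraph n (4 * m + 1)) (register hn) 30 b 3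
      (controlled fun x => Matrix.diagonal fun g => ∏ j, ∏ i, phase (β j) (xor (x i) (g j))) := by
  refine realizes_running_phases hn hQ (fun _ => true) (fun _ => false) (fun _ => true)
    (fun p => β p.2) _ fun x g R hR => ?_
  simp only [hR.eq_data, Bool.true_and]
  rw [Fintype.prod_prod_type, Finset.prod_comm]

theorem realizes_parity_phases (hn : 0 < n) {b : ℕ} (hQ : n * (4 * m + 1) ≤ 2 ^ b)
    (S : Fin n → Finset (Fin m)) (α : ℝ) :
    Realizes (gridGraph n (4 * m + 1)) (register hn) 30 b 3
      (controlled fun _ => Matrix.diagonal fun g => ∏ i, phase α (parity (S i) g)) := by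
  refine realizes_running_phases hn hQ (fun p => decide (p.2.1 ≠ 0)) (fun p => decide (p.2 ∈ S p.1))
    (fun _ => false) (fun p => if p.2.1 + 1 = m then α else 0) _ fun x g R hR => ?_
  simp only [hR.eq_parity, Bool.false_and, Bool.xor_false]
  rw [Fintype.prod_prod_type]
  refine Finset.prod_congr rfl fun i _ => ?_
  cases m with
  | zero => simp [Subsingleton.elim (S i) ∅]
  | succ m =>
    have val_ne (j : Fin m) : j.1 ≠ m := j.2.ne
    have Iic_last : Finset.Iic (Fin.last m) = Finset.univ := by
      ext j
      simp [Fin.le_last]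
    simp [Fin.prod_univ_castSucc, val_ne, Iic_last]

end Grid

/-! ### Testing the Hamming weight -/

section Weight

variable {n : ℕ}

/-- The Hamming weight. -/
def weight (x : Fin n → Bool) : ℕ := (Finset.univ.filter fun i => x i = true).card

theorem weight_le (x : Fin n → Bool) : weight x ≤ n :=
  (Finset.card_le_univ _).trans_eq (Fintype.card_fin n)

theorem weight_add_card_filter_false (x : Fin n → Bool) :
    weight x + (Finset.univ.filter fun i => x i = false).card = n := by
  have h := Finset.card_filter_add_card_filter_not (s := Finset.univ) fun i => x i = true
  simpa only [weight, Bool.not_eq_true, Finset.card_fin] using h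

theorem prod_phase {ι : Type} (s : Finset ι) (θ : ℝ) (f : ι → Bool) :
    ∏ i ∈ s, phase θ (f i) = Complex.exp (θ * Complex.I) ^ (s.filter fun i => f i = true).card := by
  simp only [phase]
  rw [Finset.prod_ite, Finset.prod_const, Finset.prod_const_one, mul_one]

theorem prod_phase_not (θ : ℝ) (x : Fin n → Bool) :
    ∏ i, phase θ (!x i) = Complex.exp (θ * (n - weight x : ℝ) * Complex.I) := by
  have card_eq : (n : ℝ) - weight x = (Finset.univ.filter fun i => x i = false).card :=
    sub_eq_of_eq_add' (by exact_mod_cast (weight_add_card_filter_false x).symm)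
  rw [prod_phase, card_eq, ← Complex.exp_nat_mul]
  simp only [Bool.not_eq_true', Complex.ofReal_natCast]
  ring_nf

theorem exp_pi_mul_div_eq_neg_one {v : ℤ} (hv : Odd v) (k : ℕ) :
    Complex.exp ((Real.pi * (2 ^ k * v : ℤ) / 2 ^ k : ℝ) * Complex.I) = -1 := by
  have angle_eq : ((Real.pi * (2 ^ k * v : ℤ) / 2 ^ k : ℝ) : ℂ) * Complex.I =
      v * (Real.pi * Complex.I) := by
    push_cast
    field_simp
  rw [angle_eq, Complex.exp_int_mul, Complex.exp_pi_mul_I, hv.neg_one_zpow]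

theorem exists_exp_eq_neg_one {m : ℕ} {z : ℤ} (hz : z ≠ 0) (hzm : z.natAbs < 2 ^ m) :
    ∃ j : Fin m, Complex.exp ((Real.pi * z / 2 ^ j.1 : ℝ) * Complex.I) = -1 := by
  obtain ⟨k, u, hu, hk⟩ := Nat.exists_eq_two_pow_mul_odd (Int.natAbs_ne_zero.2 hz)
  have hkm : k < m := by
    refine (Nat.pow_lt_pow_iff_right one_lt_two).1 (lt_of_le_of_lt ?_ hzm)
    rw [hk]
    exact Nat.le_mul_of_pos_right _ hu.pos
  obtain ⟨v, rfl⟩ : (2 ^ k : ℤ) ∣ z := by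
    rw [← Int.natAbs_dvd_natAbs, hk]
    simp [Int.natAbs_pow]
  have hv : Odd v := by
    rw [Int.natAbs_mul, Int.natAbs_pow] at hk
    rw [← Int.natAbs_odd, Nat.eq_of_mul_eq_mul_left (by positivity) hk]
    exact hu
  exact ⟨⟨k, hkm⟩, by exact_mod_cast exp_pi_mul_div_eq_neg_one hv k⟩

/-- The diagonal gate on a qubit `c` that collects the phases `θ` of all bits `x i ⊕ c`. -/
noncomputable def xorPhaseGate (θ : ℝ) (x : Fin n → Bool) : Matrix.unitaryGroup Bool ℂ :=
  ⟨Matrix.diagonal fun c => ∏ i, phase θ (xor (x i) c), Matrix.mem_unitaryGroup_iff.2 (by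
    rw [Matrix.star_eq_conjTranspose, Matrix.diagonal_conjTranspose, Matrix.diagonal_mul_diagonal]
    simp only [Pi.star_apply, star_prod, ← Finset.prod_mul_distrib, phase_mul_star,
      Finset.prod_const_one]
    exact Matrix.diagonal_one)⟩

theorem star_phase (θ : ℝ) (b : Bool) : star (phase θ b) = phase (-θ) b := by
  cases b
  · simp
  · simp only [phase_true, Complex.star_def, ← Complex.exp_conj]
    simp

theorem star_xorPhaseGate (θ : ℝ) (x : Fin n → Bool) :
    star (xorPhaseGate θ x) = xorPhaseGate (-θ) x := by
  refine Subtype.ext ((Matrix.diagonal_conjTranspose _).trans (congrArg _ (funext fun c => ?_)))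
  simp only [Pi.star_apply, star_prod, star_phase]

/-- The gate that tests the Hamming weight of `x` against `t` modulo `2 ^ (j + 1)`. Its angles are
such that, between the Hadamard gates, `|0⟩` and `|1⟩` collect phases with the ratio
`exp (i π (weight x - t) / 2 ^ j)`. -/
noncomputable def weightTest (t : ℕ) (x : Fin n → Bool) (j : ℕ) : Matrix.unitaryGroup Bool ℂ :=
  hadamardGate * (xorPhaseGate (-(Real.pi / 2 ^ (j + 1))) x *
    (phaseGate (Real.pi * n / 2 ^ (j + 1) - Real.pi * t / 2 ^ j) * hadamardGate))

theorem hadamardMatrix_mul_diagonal_mul_hadamardMatrix_apply (d : Bool → ℂ) (c : Bool) :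
    (hadamardMatrix * (Matrix.diagonal d * hadamardMatrix)) c false =
      1 / 2 * (d false + bsign c * d true) := by
  rw [Matrix.mul_apply, Fintype.sum_bool]
  simp only [Matrix.diagonal_mul, hadamardMatrix, Matrix.of_apply, Bool.and_false, Bool.and_true,
    bsign_false, ← inv_sqrt_two_mul_self]
  ring

theorem prod_phase_xor_true_mul_phase (t : ℕ) (x : Fin n → Bool) (j : ℕ) :
    (∏ i, phase (-(Real.pi / 2 ^ (j + 1))) (xor (x i) true)) *
        phase (Real.pi * n / 2 ^ (j + 1) - Real.pi * t / 2 ^ j) true =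
      (∏ i, phase (-(Real.pi / 2 ^ (j + 1))) (x i)) *
        Complex.exp ((Real.pi * (weight x - t : ℤ) / 2 ^ j : ℝ) * Complex.I) := by
  simp only [Bool.xor_true, prod_phase_not]
  rw [prod_phase, phase_true, ← weight, ← Complex.exp_nat_mul, ← Complex.exp_add,
    ← Complex.exp_add]
  congr 1
  push_cast
  field_simp
  ring

theorem weightTest_apply (t : ℕ) (x : Fin n → Bool) (j : ℕ) (c : Bool) :
    (weightTest t x j).1 c false =
      1 / 2 * (∏ i, phase (-(Real.pi / 2 ^ (j + 1))) (x i)) *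
        (1 + bsign c *
          Complex.exp ((Real.pi * (weight x - t : ℤ) / 2 ^ j : ℝ) * Complex.I)) := by
  have matrix_eq : (weightTest t x j).1 = hadamardMatrix * (Matrix.diagonal (fun c =>
      (∏ i, phase (-(Real.pi / 2 ^ (j + 1))) (xor (x i) c)) *
        phase (Real.pi * n / 2 ^ (j + 1) - Real.pi * t / 2 ^ j) c) * hadamardMatrix) := by
    rw [← Matrix.diagonal_mul_diagonal, Matrix.mul_assoc]
    rfl
  rw [matrix_eq, hadamardMatrix_mul_diagonal_mul_hadamardMatrix_apply,
    prod_phase_xor_true_mul_phase]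
  simp only [Bool.xor_false, phase_false]
  ring

theorem reflection_mul_prod_weightTest {m t : ℕ} (ht : t < 2 ^ m) {x : Fin n → Bool}
    (hx : weight x < 2 ^ m) (y : Fin m → Bool) :
    (if y = fun _ => false then 1 else -1) * ∏ j : Fin m, (weightTest t x j).1 (y j) false =
      (if weight x = t then 1 else -1) * ∏ j : Fin m, (weightTest t x j).1 (y j) false := by
  by_cases hw : weight x = t <;> by_cases hy : y = fun _ => false
  · rw [if_pos hy, if_pos hw]
  · obtain ⟨j, hj⟩ := Function.ne_iff.1 hy
    have vanishes : (weightTest t x j).1 (y j) false = 0 := by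
      simp [weightTest_apply, hw, Bool.eq_true_of_not_eq_false hj]
    rw [Finset.prod_eq_zero (Finset.mem_univ j) vanishes, mul_zero, mul_zero]
  · obtain ⟨j, hj⟩ := exists_exp_eq_neg_one (m := m) (z := weight x - t)
      (sub_ne_zero.2 (Nat.cast_injective.ne hw)) (by omega)
    have vanishes : (weightTest t x j).1 (y j) false = 0 := by
      rw [weightTest_apply, hj, hy, bsign_false]
      ring
    rw [Finset.prod_eq_zero (Finset.mem_univ j) vanishes, mul_zero, mul_zero]
  · rw [if_neg hy, if_neg hw]

end Weight

/-! ### Reflections -/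

section Reflections

open Matrix

variable {Q : Type} [Fintype Q]

theorem ket_apply {Q : Type} (x y : Q → Bool) [Decidable (x = y)] :
    ket y x = if x = y then 1 else 0 := by
  rw [ket]
  congr

theorem card_filter_parity_eq_true {g : Q → Bool} (hg : g ≠ fun _ => false) :
    2 * (Finset.univ.filter fun S : Finset Q => parity S g = true).card = 2 ^ Fintype.card Q := by
  classical
  obtain ⟨q, hq⟩ := Function.ne_iff.1 hg
  have parity_flip (S : Finset Q) : parity (symmDiff S {q}) g = !parity S g := by
    rw [parity_symmDiff, parity_singleton, Bool.eq_true_of_not_eq_false hq, Bool.xor_true]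
  have card_eq : (Finset.univ.filter fun S : Finset Q => parity S g = true).card =
      (Finset.univ.filter fun S : Finset Q => ¬ parity S g = true).card :=
    Finset.card_nbij' (symmDiff · {q}) (symmDiff · {q})
      (fun S hS => by simpa [parity_flip] using hS) (fun S hS => by simpa [parity_flip] using hS)
      (fun S _ => symmDiff_symmDiff_cancel_right _ _) fun S _ => symmDiff_symmDiff_cancel_right _ _
  have total := Finset.card_filter_add_card_filter_not (s := Finset.univ)
    fun S : Finset Q => parity S g = true
  rw [Finset.card_univ, Fintype.card_finset] at total
  omega

variable [DecidableEq Q]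

theorem tensorMatrix_mulVec_ket (W : Q → Matrix Bool Bool ℂ) (y x : Q → Bool) :
    (tensorMatrix W *ᵥ ket y) x = ∏ q, W q (x q) (y q) := by
  rw [tensorMatrix_mulVec_eq_single W _ x y fun z hz => Or.inr (by rw [ket_apply, if_neg hz]),
    ket_apply, if_pos rfl, mul_one]

/-- The phase kickback. -/
theorem star_mul_diagonal_mul_mulVec_ket (V : Q → Matrix.unitaryGroup Bool ℂ) {y : Q → Bool}
    {d : (Q → Bool) → ℂ} {c : ℂ}
    (hd : ∀ x, d x * ∏ q, (V q).1 (x q) (y q) = c * ∏ q, (V q).1 (x q) (y q)) :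
    (tensorMatrix (fun q => star (V q).1) * (diagonal d * tensorMatrix fun q => (V q).1)) *ᵥ
      ket y = c • ket y := by
  have eigenvector : diagonal d *ᵥ (tensorMatrix (fun q => (V q).1) *ᵥ ket y) =
      c • (tensorMatrix (fun q => (V q).1) *ᵥ ket y) := by
    funext x
    rw [mulVec_diagonal, Pi.smul_apply, smul_eq_mul, tensorMatrix_mulVec_ket, hd]
  rw [← mulVec_mulVec, ← mulVec_mulVec, eigenvector, mulVec_smul, mulVec_mulVec, tensorMatrix_mul]
  simp only [mem_unitaryGroup_iff'.1 (V _).2, tensorMatrix_one, one_mulVec]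

theorem prod_phase_parity {m : ℕ} (g : Fin (m + 1) → Bool) :
    ∏ S, phase (Real.pi / 2 ^ m) (parity S g) = if g = fun _ => false then 1 else -1 := by
  split_ifs with hg
  · refine Finset.prod_eq_one fun S _ => ?_
    rw [hg, parity_const_false, phase_false]
  · have card_eq := card_filter_parity_eq_true hg
    rw [Fintype.card_fin, pow_succ', Nat.mul_right_inj two_ne_zero] at card_eq
    rw [prod_phase, card_eq, ← Complex.exp_nat_mul, ← Complex.exp_pi_mul_I]
    congr 1
    push_cast
    field_simp

end Reflections

/-! ### Phase oracles on the grid -/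

namespace Grid

open Matrix

variable {n m b : ℕ}

theorem realizes_aux_gates (hn : 0 < n) (hQ : n * (4 * m + 1) ≤ 2 ^ b)
    (W : Fin m → unitaryGroup Bool ℂ) :
    Realizes (gridGraph n (4 * m + 1)) (register hn) 30 b 1
      (controlled fun _ => tensorMatrix fun j => (W j).1) := by
  have h := realizes_tensorMatrix (G := gridGraph n (4 * m + 1)) (D := 30)
    (register_injective (m := m) hn) (by simpa using hQ) (by norm_num) (Sum.elim (fun _ => 1) W)
  rw [controlled_tensorMatrix]
  convert h using 2
  funext i
  cases i <;> rfl

theorem realizes_data_gates (hn : 0 < n) (hQ : n * (4 * m + 1) ≤ 2 ^ b)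
    (U : Fin n → unitaryGroup Bool ℂ) :
    Realizes (gridGraph n (4 * m + 1)) (register (m := m) hn) 30 b 1
      (tensorMatrix (Sum.elim (fun i => (U i).1) fun _ => 1)) := by
  have h := realizes_tensorMatrix (G := gridGraph n (4 * m + 1)) (D := 30)
    (register_injective (m := m) hn) (by simpa using hQ) (by norm_num) (Sum.elim U fun _ => 1)
  convert h using 2
  funext i
  cases i <;> rfl

theorem realizes_reflection (hn : 0 < n) (hm : 2 ^ m ≤ n)
    (hQ : n * (4 * (m + 1) + 1) ≤ 2 ^ b) :
    Realizes (gridGraph n (4 * (m + 1) + 1)) (register hn) 30 b 6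
      (controlled fun _ => diagonal fun g => if g = fun _ => false then 1 else -1) := by
  -- A parity circuit has room for `n` subsets, and there are `2 ^ (m + 1) ≤ 2 * n` of them.
  obtain ⟨e⟩ : Nonempty (Finset (Fin (m + 1)) ↪ Bool × Fin n) := by
    refine Function.Embedding.nonempty_of_card_le ?_
    simp only [Fintype.card_finset, Fintype.card_prod, Fintype.card_bool, Fintype.card_fin]
    omega
  let S (c : Bool) (i : Fin n) : Finset (Fin (m + 1)) := Function.extend e id (fun _ => ∅) (c, i)
  have prod_eq (g : Fin (m + 1) → Bool) :
      ∏ T, phase (Real.pi / 2 ^ m) (parity T g) =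
        ∏ p : Bool × Fin n, phase (Real.pi / 2 ^ m) (parity (S p.1 p.2) g) := by
    refine Fintype.prod_of_injective e e.injective _ _ (fun p hp => ?_) fun T => ?_
    · rw [show S p.1 p.2 = ∅ from Function.extend_apply' _ _ _ hp, parity_empty, phase_false]
    · rw [show S (e T).1 (e T).2 = T from e.injective.extend_apply _ _ _]
  have h := (realizes_parity_phases hn hQ (S true) (Real.pi / 2 ^ m)).mul
    (realizes_parity_phases hn hQ (S false) (Real.pi / 2 ^ m))
  simp only [controlled_mul, diagonal_mul_diagonal] at h
  simpa only [← prod_phase_parity, prod_eq, Fintype.prod_prod_type, Fintype.prod_bool] using h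

theorem realizes_xor_phases_between (hn : 0 < n) (hQ : n * (4 * m + 1) ≤ 2 ^ b)
    (U W : Fin m → unitaryGroup Bool ℂ) (β : Fin m → ℝ) :
    Realizes (gridGraph n (4 * m + 1)) (register hn) 30 b 5
      (controlled fun x => tensorMatrix fun j => (U j * (xorPhaseGate (β j) x * W j)).1) := by
  have h := (realizes_aux_gates hn hQ U).mul
    ((realizes_xor_phases hn hQ β).mul (realizes_aux_gates hn hQ W))
  have diagonal_eq (x : Fin n → Bool) :
      (diagonal fun g : Fin m → Bool => ∏ j, ∏ i, phase (β j) (xor (x i) (g j))) =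
        tensorMatrix fun j => (xorPhaseGate (β j) x).1 :=
    (tensorMatrix_diagonal fun j c => ∏ i, phase (β j) (xor (x i) c)).symm
  simp only [controlled_mul, diagonal_eq, tensorMatrix_mul] at h
  exact h

theorem realizes_weightTest (hn : 0 < n) (hQ : n * (4 * m + 1) ≤ 2 ^ b) (t : ℕ) :
    Realizes (gridGraph n (4 * m + 1)) (register (m := m) hn) 30 b 5
      (controlled fun x => tensorMatrix fun j => (weightTest t x j).1) :=
  realizes_xor_phases_between hn hQ _ _ _

theorem realizes_star_weightTest (hn : 0 < n) (hQ : n * (4 * m + 1) ≤ 2 ^ b) (t : ℕ) :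
    Realizes (gridGraph n (4 * m + 1)) (register (m := m) hn) 30 b 5
      (controlled fun x => tensorMatrix fun j => star (weightTest t x j).1) := by
  have star_eq (x : Fin n → Bool) (j : ℕ) :
      star (weightTest t x j) = star (phaseGate (Real.pi * n / 2 ^ (j + 1) -
        Real.pi * t / 2 ^ j) * hadamardGate) *
          (xorPhaseGate (Real.pi / 2 ^ (j + 1)) x * star hadamardGate) := by
    rw [weightTest, star_mul, star_mul (xorPhaseGate _ _), star_xorPhaseGate, neg_neg, mul_assoc]
  have h := realizes_xor_phases_between hn hQ (fun j : Fin m => star (phaseGate (Real.pi * n /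
    2 ^ (j.1 + 1) - Real.pi * t / 2 ^ j.1) * hadamardGate)) (fun _ => star hadamardGate)
    fun j => Real.pi / 2 ^ (j.1 + 1)
  simp only [← star_eq] at h
  exact h

theorem exists_realizes_weight_oracle (hn : 0 < n) (hm : 2 ^ m ≤ n) (hm' : n < 2 ^ (m + 1))
    (hQ : n * (4 * (m + 1) + 1) ≤ 2 ^ b) {t : ℕ} (ht : t ≤ n) :
    ∃ T, Realizes (gridGraph n (4 * (m + 1) + 1)) (register hn) 30 b 16 (controlled T) ∧
      ∀ x, T x *ᵥ ket (fun _ => false) =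
        (if weight x = t then 1 else -1 : ℂ) • ket fun _ => false := by
  have h := (realizes_star_weightTest hn hQ t).mul
    ((realizes_reflection hn hm hQ).mul (realizes_weightTest hn hQ t))
  rw [controlled_mul, controlled_mul] at h
  exact ⟨_, h, fun x => star_mul_diagonal_mul_mulVec_ket _
    (reflection_mul_prod_weightTest (ht.trans_lt hm') ((weight_le x).trans_lt hm'))⟩

end Grid

/-! ### Amplitude amplification -/

section Amplification

open Matrix

/-- With success probability `1 / 4`, a single Grover iteration is exact: it rotates the angle
`π / 6` to `π / 2`. -/
theorem grover_step {Q : Type} [Fintype Q] [DecidableEq Q] {V V' : Matrix (Q → Bool) (Q → Bool) ℂ}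
    (hV : V * V' = 1) (P : (Q → Bool) → Prop) [DecidablePred P]
    (hP : (V' *ᵥ fun x => (if P x then 1 else -1) * (V *ᵥ ket fun _ => false) x) (fun _ => false) =
      -(1 / 2)) :
    (V *ᵥ fun x => (if x = fun _ => false then 1 else -1) *
      (V' *ᵥ fun x => (if P x then 1 else -1) * (V *ᵥ ket fun _ => false) x) x) =
    fun x => if P x then -2 * (V *ᵥ ket fun _ => false) x else 0 := by
  set s := V *ᵥ ket fun _ => false with hs
  set f : QState Q := fun x => (if P x then 1 else -1) * s x with hf
  have reflected : (fun x => (if x = fun _ => false then 1 else -1) * (V' *ᵥ f) x) =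
      -(V' *ᵥ f) - ket fun _ => false := by
    funext x
    rw [Pi.sub_apply, Pi.neg_apply, ket_apply]
    split_ifs with hx
    · rw [hx, hP]
      norm_num
    · ring
  rw [reflected, mulVec_sub, mulVec_neg, mulVec_mulVec, hV, one_mulVec, ← hs]
  funext x
  simp only [Pi.sub_apply, Pi.neg_apply, hf]
  split_ifs
  · ring
  · ring

theorem exists_sin_sq_mul_cos_sq_pow {n : ℕ} (hn : 1 ≤ n) :
    ∃ θ : ℝ, n * (Real.sin θ ^ 2 * (Real.cos θ ^ 2) ^ (n - 1)) = 1 / 4 := by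
  have one_le : (1 : ℝ) ≤ n := by exact_mod_cast hn
  have le_half : (1 : ℝ) / (2 * n) ≤ 1 / 2 := one_div_le_one_div_of_le two_pos (by linarith)
  obtain ⟨θ, hθ⟩ : ∃ θ, Real.sin θ ^ 2 = 1 / (2 * n) := by
    refine ⟨Real.arcsin √(1 / (2 * n)), ?_⟩
    rw [Real.sin_arcsin (by linarith [Real.sqrt_nonneg (1 / (2 * n : ℝ))])
      (Real.sqrt_le_one.2 (by linarith)), Real.sq_sqrt (by positivity)]
  have bernoulli : 1 / 2 ≤ (Real.cos θ ^ 2) ^ (n - 1) := by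
    have h := one_add_mul_le_pow (a := -(1 / (2 * n) : ℝ)) (by linarith) (n - 1)
    rw [Real.cos_sq', hθ]
    refine le_trans ?_ (h.trans_eq (by rw [sub_eq_add_neg]))
    rw [Nat.cast_sub hn]
    field_simp
    push_cast
    linarith
  refine mem_range_of_exists_le_of_exists_ge (by fun_prop) ⟨0, by simp⟩ ⟨θ, ?_⟩
  rw [hθ]
  calc (1 : ℝ) / 4 ≤ 1 / 2 * (Real.cos θ ^ 2) ^ (n - 1) := by linarith
    _ = n * (1 / (2 * n) * (Real.cos θ ^ 2) ^ (n - 1)) := by field_simp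

/-- The amplitudes of the rotated qubit `cos θ |0⟩ + sin θ |1⟩`. -/
noncomputable def amplitude (θ : ℝ) (b : Bool) : ℝ := if b then Real.sin θ else Real.cos θ

theorem sum_amplitude_sq (θ : ℝ) : ∑ b, amplitude θ b ^ 2 = 1 := by
  simp [amplitude]

/-- The rotation that maps `|0⟩` to `cos θ |0⟩ + sin θ |1⟩`. -/
noncomputable def rotationGate (θ : ℝ) : unitaryGroup Bool ℂ :=
  ⟨Matrix.of fun a b => (if b then (if a then amplitude θ false else -amplitude θ true)
      else amplitude θ a : ℝ), mem_unitaryGroup_iff.2 (by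
    have h : (Real.sin θ : ℂ) ^ 2 + (Real.cos θ : ℂ) ^ 2 = 1 := by
      exact_mod_cast Real.sin_sq_add_cos_sq θ
    ext a b
    rw [mul_apply, Fintype.sum_bool]
    simp only [of_apply, star_apply, amplitude, RCLike.star_def, Complex.conj_ofReal, one_apply]
    cases a <;> cases b <;>
      simp only [↓reduceIte, Bool.false_eq_true, Bool.true_eq_false, Complex.ofReal_neg] <;>
      first | linear_combination h | ring)⟩

theorem rotationGate_apply_false (θ : ℝ) (a : Bool) : (rotationGate θ).1 a false = amplitude θ a :=
  rfl

section WState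

variable {n : ℕ}

theorem weight_eq_zero_iff (x : Fin n → Bool) : weight x = 0 ↔ x = fun _ => false := by
  simp [weight, Finset.filter_eq_empty_iff, funext_iff]

theorem weight_eq_one_iff (x : Fin n → Bool) :
    weight x = 1 ↔ ∃ i, (fun j => decide (j = i)) = x := by
  rw [weight, Finset.card_eq_one]
  refine exists_congr fun i => ?_
  simp only [Finset.ext_iff, Finset.mem_filter, Finset.mem_univ, true_and, Finset.mem_singleton,
    funext_iff]
  exact forall_congr' fun j => by cases x j <;> simp

theorem unitString_injective : Function.Injective fun i j : Fin n => decide (j = i) := by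
  intro i i' h
  simpa using congrFun h i

theorem prod_unitString {M : Type} [CommMonoid M] (v : Bool → M) (i : Fin n) :
    ∏ j, v (decide (j = i)) = v true * v false ^ (n - 1) := by
  have prod_erase : ∏ j ∈ Finset.univ.erase i, v (decide (j = i)) =
      ∏ _j ∈ Finset.univ.erase i, v false :=
    Finset.prod_congr rfl fun j hj => by rw [decide_eq_false (Finset.ne_of_mem_erase hj)]
  rw [← Finset.mul_prod_erase _ _ (Finset.mem_univ i), prod_erase, Finset.prod_const,
    Finset.card_erase_of_mem (Finset.mem_univ i), Finset.card_univ, Fintype.card_fin,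
    decide_eq_true rfl]

theorem wState_apply (x : Fin n → Bool) :
    wState n x = if weight x = 1 then ((1 / √n : ℝ) : ℂ) else 0 := by
  simp only [wState, Pi.smul_apply, Finset.sum_apply, smul_eq_mul, ket_apply]
  split_ifs with hx
  · obtain ⟨i, rfl⟩ := (weight_eq_one_iff x).1 hx
    simp only [unitString_injective.eq_iff, Finset.sum_ite_eq, Finset.mem_univ, if_true, mul_one]
  · rw [Finset.sum_eq_zero fun i _ => if_neg fun h => hx ((weight_eq_one_iff x).2 ⟨i, h.symm⟩),
      mul_zero]

theorem sum_ite_weight_eq_one (F : (Fin n → Bool) → ℂ) :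
    ∑ x, (if weight x = 1 then F x else 0) = ∑ i, F fun j => decide (j = i) := by
  symm
  refine Fintype.sum_of_injective _ unitString_injective _ _ (fun x hx => ?_) fun i => ?_
  · exact if_neg fun h => hx ((weight_eq_one_iff x).1 h)
  · rw [if_pos ((weight_eq_one_iff _).2 ⟨i, rfl⟩)]

/-- The state of `n` qubits that are all rotated by the angle `θ`. -/
noncomputable def rotatedState (n : ℕ) (θ : ℝ) : QState (Fin n) :=
  tensorMatrix (fun _ => (rotationGate θ).1) *ᵥ ket fun _ => false

theorem rotatedState_apply (θ : ℝ) (x : Fin n → Bool) :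
    rotatedState n θ x = ∏ i, (amplitude θ (x i) : ℂ) := by
  simp only [rotatedState, tensorMatrix_mulVec_ket, rotationGate_apply_false]

theorem rotatedState_unitString (θ : ℝ) (i : Fin n) :
    rotatedState n θ (fun j => decide (j = i)) = Real.sin θ * Real.cos θ ^ (n - 1) := by
  rw [rotatedState_apply, prod_unitString fun b => (amplitude θ b : ℂ)]
  rfl

theorem sum_rotatedState_sq (θ : ℝ) : ∑ x, rotatedState n θ x ^ 2 = 1 := by
  have h := Finset.prod_univ_sum (fun _ : Fin n => (Finset.univ : Finset Bool))
    fun _ b => (amplitude θ b : ℂ) ^ 2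
  rw [Fintype.piFinset_univ] at h
  have sum_eq : ∑ b, (amplitude θ b : ℂ) ^ 2 = 1 := by exact_mod_cast sum_amplitude_sq θ
  simp only [rotatedState_apply, ← Finset.prod_pow]
  rw [← h, sum_eq, Finset.prod_const_one]

theorem sum_weight_one_rotatedState_sq {θ : ℝ}
    (hθ : n * (Real.sin θ ^ 2 * (Real.cos θ ^ 2) ^ (n - 1)) = 1 / 4) :
    ∑ x, (if weight x = 1 then rotatedState n θ x ^ 2 else 0) = 1 / 4 := by
  simp only [sum_ite_weight_eq_one, rotatedState_unitString]
  rw [Finset.sum_const, Finset.card_univ, Fintype.card_fin, nsmul_eq_mul, mul_pow, ← pow_mul,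
    mul_comm (n - 1), pow_mul]
  have h := congrArg Complex.ofReal hθ
  push_cast at h ⊢
  exact h

theorem star_tensorMatrix_mulVec_apply_zero (θ : ℝ) (f : QState (Fin n)) :
    (tensorMatrix (fun _ => star (rotationGate θ).1) *ᵥ f) (fun _ => false) =
      ∑ x, rotatedState n θ x * f x := by
  rw [tensorMatrix_mulVec]
  simp only [rotatedState_apply, star_apply, rotationGate_apply_false, Complex.star_def,
    Complex.conj_ofReal]

theorem exists_grover_eq_smul_wState {θ : ℝ} (hn : 1 ≤ n)
    (hθ : n * (Real.sin θ ^ 2 * (Real.cos θ ^ 2) ^ (n - 1)) = 1 / 4) :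
    ∃ c : ℂ, (tensorMatrix (fun _ => (rotationGate θ).1) *ᵥ
      fun x => (if weight x = 0 then 1 else -1) *
        (tensorMatrix (fun _ => star (rotationGate θ).1) *ᵥ
          fun x => (if weight x = 1 then 1 else -1) * rotatedState n θ x) x) = c • wState n := by
  have unitary : tensorMatrix (fun _ : Fin n => (rotationGate θ).1) *
      tensorMatrix (fun _ => star (rotationGate θ).1) = 1 := by
    simp only [tensorMatrix_mul, mem_unitaryGroup_iff.1 (rotationGate θ).2, tensorMatrix_one]
  have overlap : (tensorMatrix (fun _ => star (rotationGate θ).1) *ᵥ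
      fun x => (if weight x = 1 then 1 else -1) * rotatedState n θ x) (fun _ => false) =
        -(1 / 2) := by
    have summand (x : Fin n → Bool) :
        rotatedState n θ x * ((if weight x = 1 then 1 else -1) * rotatedState n θ x) =
          2 * (if weight x = 1 then rotatedState n θ x ^ 2 else 0) - rotatedState n θ x ^ 2 := by
      split_ifs <;> ring
    rw [star_tensorMatrix_mulVec_apply_zero]
    simp only [summand]
    rw [Finset.sum_sub_distrib, ← Finset.mul_sum, sum_weight_one_rotatedState_sq hθ,
      sum_rotatedState_sq]
    norm_num
  have sqrt_ne_zero : ((√n : ℝ) : ℂ) ≠ 0 := by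
    rw [Complex.ofReal_ne_zero, Real.sqrt_ne_zero']
    exact_mod_cast hn
  refine ⟨-2 * √n * (Real.sin θ * Real.cos θ ^ (n - 1)), ?_⟩
  simp only [weight_eq_zero_iff]
  rw [rotatedState, grover_step unitary (weight · = 1) overlap, ← rotatedState]
  funext x
  rw [Pi.smul_apply, smul_eq_mul, wState_apply]
  split_ifs with hx
  · obtain ⟨i, rfl⟩ := (weight_eq_one_iff x).1 hx
    rw [rotatedState_unitString]
    push_cast
    field_simp
  · rw [mul_zero]

end WState

end Amplification

/-! ### The circuits -/

section Embedding

variable {Q ι κ : Type}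

theorem prodState_ket (x : ι → Bool) (y : κ → Bool) :
    prodState (ket x) (ket y) = ket (Sum.elim x y) := by
  classical
  funext z
  have eq_iff : z = Sum.elim x y ↔ z ∘ Sum.inl = x ∧ z ∘ Sum.inr = y := by
    constructor
    · rintro rfl
      exact ⟨rfl, rfl⟩
    · rintro ⟨rfl, rfl⟩
      exact (Sum.elim_comp_inl_inr z).symm
  simp only [prodState, ket_apply, eq_iff, ite_and, ite_mul, one_mul, zero_mul]

theorem registerState_ket_false (X : ι → Q) :
    registerState X (ket fun _ => false) = ket fun _ => false := by
  classical
  funext z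
  simp only [registerState, ket_apply, ← ite_and]
  refine if_congr ⟨fun ⟨blank, h⟩ => funext fun q => ?_, ?_⟩ rfl rfl
  · by_cases hq : q ∈ Set.range X
    · obtain ⟨i, rfl⟩ := hq
      exact congrFun h i
    · exact blank q hq
  · rintro rfl
    exact ⟨fun _ _ => rfl, rfl⟩

theorem registerState_prodState_ket_false {X : ι → Q} {Y : κ → Q}
    (hXY : ∀ i j, X i ≠ Y j) (f : QState ι) :
    registerState (Sum.elim X Y) (prodState f (ket fun _ => false)) = registerState X f := by
  classical
  funext z
  have comp_inl : (z ∘ Sum.elim X Y) ∘ Sum.inl = z ∘ X := rfl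
  have comp_inr : (z ∘ Sum.elim X Y) ∘ Sum.inr = z ∘ Y := rfl
  have blank_iff : ((∀ q, q ∉ Set.range (Sum.elim X Y) → z q = false) ∧
      z ∘ Y = fun _ => false) ↔ ∀ q, q ∉ Set.range X → z q = false := by
    simp only [Set.Sum.elim_range, Set.mem_union, not_or, and_imp]
    constructor
    · rintro ⟨blank, hY⟩ q hq
      by_cases hq' : q ∈ Set.range Y
      · obtain ⟨j, rfl⟩ := hq'
        exact congrFun hY j
      · exact blank q hq hq'
    · intro blank
      exact ⟨fun q hq _ => blank q hq, funext fun j => blank _ fun ⟨i, hi⟩ => hXY i j hi⟩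
  simp only [registerState, prodState, comp_inl, comp_inr, ket_apply, mul_ite, mul_one, mul_zero,
    ← ite_and, blank_iff]

end Embedding

namespace Grid

open Matrix

variable {n m b : ℕ}

theorem exists_realizes_wState (hn : 1 ≤ n) (hm : 2 ^ m ≤ n) (hm' : n < 2 ^ (m + 1))
    (hQ : n * (4 * (m + 1) + 1) ≤ 2 ^ b) :
    ∃ M, Realizes (gridGraph n (4 * (m + 1) + 1)) (register hn) 30 b 35 M ∧
      ∃ c : ℂ, M *ᵥ prodState (ket fun _ => false) (ket fun _ => false) =
        prodState (c • wState n) (ket fun _ => false) := by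
  obtain ⟨θ, hθ⟩ := exists_sin_sq_mul_cos_sq_pow hn
  obtain ⟨T₁, realizes_T₁, hT₁⟩ := exists_realizes_weight_oracle hn hm hm' hQ hn
  obtain ⟨T₀, realizes_T₀, hT₀⟩ := exists_realizes_weight_oracle hn hm hm' hQ (Nat.zero_le n)
  obtain ⟨c, hc⟩ := exists_grover_eq_smul_wState hn hθ
  have realizes_rotation := realizes_data_gates hn hQ fun _ => rotationGate θ
  have realizes_inverse := realizes_data_gates hn hQ fun _ => star (rotationGate θ)
  refine ⟨_, realizes_rotation.mul (realizes_T₀.mul (realizes_inverse.mul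
    (realizes_T₁.mul realizes_rotation))), c, ?_⟩
  simp only [← mulVec_mulVec]
  rw [tensorMatrix_mulVec_prodState, controlled_mulVec_prodState hT₁,
    tensorMatrix_mulVec_prodState, controlled_mulVec_prodState hT₀, tensorMatrix_mulVec_prodState,
    ← rotatedState]
  exact congrArg (prodState · _) hc

theorem exists_prepares_wState (hn : 1 ≤ n) (hm : 2 ^ m ≤ n) (hm' : n < 2 ^ (m + 1))
    (hQ : n * (4 * (m + 1) + 1) ≤ 2 ^ b) :
    ∃ A : HybridCircuit (gridGraph n (4 * (m + 1) + 1)), HybridCircuit.Bounded 35 30 b A ∧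
      ∃ out, A.Prepares out (wState n) := by
  obtain ⟨M, ⟨A, hA, branches_A⟩, c, hM⟩ := exists_realizes_wState hn hm hm' hQ
  have dataSite_injective : Function.Injective (dataSite : Fin n → Fin n × Fin (4 * (m + 1) + 1)) :=
    (register_injective hn).comp Sum.inl_injective
  have ne_aux (i : Fin n) (j : Fin (m + 1)) : dataSite i ≠ auxSite hn j := fun h =>
    Sum.inl_ne_inr (register_injective hn h)
  have embed_data (f : QState (Fin n)) :
      registerState (register hn) (prodState f (ket fun _ => false)) = registerState dataSite f :=
    registerState_prodState_ket_false ne_aux f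
  refine ⟨A, hA, ⟨dataSite, dataSite_injective⟩, fun χ hχ => ?_⟩
  rw [← registerState_ket_false (register hn), ← Sum.elim_lam_const_lam_const false,
    ← prodState_ket] at hχ
  obtain ⟨c', rfl⟩ := branches_A _ _ χ hχ
  rw [hM, embed_data, registerState_smul, smul_smul]
  exact ⟨_, rfl⟩

end Grid

/-- The number of columns of the grid for `n` qubits: there is a first column for the data, and
then a cell of four columns for each of the `log₂ n + 1` auxiliary qubits. -/
def gridWidth (n : ℕ) : ℕ := 4 * (Nat.log 2 n + 1) + 1

theorem mul_gridWidth_le (n : ℕ) : n * gridWidth n ≤ 2 ^ (4 * (Nat.log 2 n + 1)) := by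
  have le_pow : n ≤ 2 ^ (Nat.log 2 n + 1) := (Nat.lt_pow_succ_log_self one_lt_two n).le
  rw [gridWidth]
  generalize Nat.log 2 n = L at le_pow
  have lt_pow : L < 2 ^ L := Nat.lt_two_pow_self
  calc n * (4 * (L + 1) + 1) ≤ 2 ^ (L + 1) * 2 ^ (L + 3) :=
        Nat.mul_le_mul le_pow (by rw [pow_add]; omega)
    _ = 2 ^ (2 * L + 4) := by rw [← pow_add]; ring_nf
    _ ≤ 2 ^ (4 * (L + 1)) := Nat.pow_le_pow_right two_pos (by omega)

theorem gridWidth_isBigO_log :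
    (fun n : ℕ => (gridWidth n : ℝ)) =O[atTop] fun n : ℕ => Real.log n := by
  have log_eventually_ge := (Real.tendsto_log_atTop.comp
    (tendsto_natCast_atTop_atTop (R := ℝ))).eventually_ge_atTop 1
  refine IsBigO.of_bound 13 ?_
  filter_upwards [log_eventually_ge] with n one_le_log
  rw [Function.comp_apply] at one_le_log
  have log_two_le : (Nat.log 2 n : ℝ) ≤ 2 * Real.log n := by
    have log_le : (Nat.log 2 n : ℝ) * Real.log 2 ≤ Real.log n := by
      rw [← le_div_iff₀ (Real.log_pos one_lt_two)]
      exact Real.natLog_le_logb n 2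
    nlinarith [Real.log_two_gt_d9, Nat.cast_nonneg (α := ℝ) (Nat.log 2 n)]
  rw [Real.norm_of_nonneg (Nat.cast_nonneg _), Real.norm_of_nonneg (by linarith), gridWidth]
  push_cast
  linarith

theorem log_isBigO_log_mul_log_log :
    (fun n : ℕ => Real.log n) =O[atTop] fun n : ℕ => Real.log n * Real.log (Real.log n) := by
  have log_log_eventually_ge := (Real.tendsto_log_atTop.comp (Real.tendsto_log_atTop.comp
    (tendsto_natCast_atTop_atTop (R := ℝ)))).eventually_ge_atTop 1
  refine IsBigO.of_bound' ?_
  filter_upwards [log_log_eventually_ge] with n one_le_log_log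
  rw [norm_mul]
  exact le_mul_of_one_le_right (norm_nonneg _) (one_le_log_log.trans (Real.le_norm_self _))

theorem two_pow_mul_log_succ_le {n : ℕ} (hn : n ≠ 0) (k : ℕ) :
    2 ^ ((Nat.log 2 n + 1) * k) ≤ (n + 1) ^ (2 * k) := by
  have le_sq : 2 ^ (Nat.log 2 n + 1) ≤ (n + 1) ^ 2 := by
    have pow_log_le := Nat.pow_log_le_self 2 hn
    rw [pow_succ]
    nlinarith
  rw [pow_mul, pow_mul]
  exact Nat.pow_le_pow_left le_sq k

theorem exists_bounded_prepares_wState (n : ℕ) : ∃ A : HybridCircuit (gridGraph n (gridWidth n)),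
    HybridCircuit.Bounded 35 30 (4 * (Nat.log 2 n + 1)) A ∧
      (∀ R ∈ A, ∑ i, (R.classical i).size ≤ (n + 1) ^ 34) ∧
      (1 ≤ n → ∃ out : Fin n ↪ Fin n × Fin (gridWidth n), A.Prepares out (wState n)) := by
  rcases Nat.eq_zero_or_pos n with rfl | hn
  · exact ⟨[], HybridCircuit.bounded_nil, fun R hR => absurd hR List.not_mem_nil,
      fun h => absurd h (by norm_num)⟩
  · obtain ⟨A, hA, prepares⟩ := Grid.exists_prepares_wState hn (Nat.pow_log_le_self 2 hn.ne')
      (Nat.lt_pow_succ_log_self one_lt_two n) (mul_gridWidth_le n)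
    refine ⟨A, hA, fun R hR => ?_, fun _ => prepares⟩
    calc ∑ i, (R.classical i).size ≤ 2 ^ (4 * (4 * (Nat.log 2 n + 1)) + 1) := hA.size_le R hR
      _ ≤ 2 ^ ((Nat.log 2 n + 1) * 17) := Nat.pow_le_pow_right two_pos (by omega)
      _ ≤ (n + 1) ^ 34 := two_pow_mul_log_succ_le hn.ne' 17

theorem theorem7p3p1_general :
    ∃ (w : ℕ → ℕ) (A : (n : ℕ) → HybridCircuit (gridGraph n (w n))),
      IsLAQCC A ∧
      (∀ n : ℕ, 1 ≤ n → ∃ out : Fin n ↪ Fin n × Fin (w n), (A n).Prepares out (wState n)) ∧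
      (fun n : ℕ => (w n : ℝ)) =O[atTop] fun n : ℕ => Real.log n := by
  choose A bounded size_le prepares using exists_bounded_prepares_wState
  exact ⟨gridWidth, A,
    { rounds := ⟨35, fun n => (bounded n).length_le⟩
      quantum_depth := ⟨30, fun n => (bounded n).quantum_le⟩
      classical_depth := ⟨12, fun n R hR i => ((bounded n).depth_le R hR i).trans (by omega)⟩
      classical_size := ⟨34, size_le⟩ },
    prepares, gridWidth_isBigO_log⟩

theorem theorem7p3p1 :
    ∃ (w : ℕ → ℕ) (A : (n : ℕ) → HybridCircuit (gridGraph n (w n))),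
      IsLAQCC A ∧
      (∀ n : ℕ, 1 ≤ n → ∃ out : Fin n ↪ Fin n × Fin (w n), (A n).Prepares out (wState n)) ∧
      (fun n : ℕ => (w n : ℝ)) =O[atTop]
        (fun n : ℕ => Real.log n * Real.log (Real.log n)) ∧
      (fun n : ℕ => (Fintype.card (Fin n × Fin (w n)) : ℝ)) =O[atTop]
        (fun n : ℕ => (n : ℝ) * Real.log n * Real.log (Real.log n)) := by
  obtain ⟨w, A, hA, prepares, hw⟩ := theorem7p3p1_general
  have hw' := hw.trans log_isBigO_log_mul_log_log
  refine ⟨w, A, hA, prepares, hw', ?_⟩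
  simpa [mul_assoc] using (isBigO_refl (fun n : ℕ => (n : ℝ)) atTop).mul hw'
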